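/- Let $d\in\{1,2,3\}$, $m,p\in\mathbb N_0$. Let $\hat K\subset\mathbb R^d$ be a reference element: a unit simplex, a unit box or a unit prism (that is, a product of unit simplices in blocks of coordinates, $\hat K=\{\hat x:\ \hat x_l\ge 0 \text{ for all } l,\ \sum_{l\in r}\hat x_l\le 1 \text{ for every block } r\}$). Let $(\hat\phi_i)_{i=1}^N$ be the Bernstein basis of degree $p$ on $\hat K$ (the products over the blocks of the Bernstein polynomials of degree $p$ on the simplices), and let $\hat x_i$ be the associated uniformly distributed nodes. Let $K^1,\dots,K^E\subset\mathbb R^d$ be elements $K^e=F^e(\hat K^e)$, where each $\hat K^e$ is such a reference element and $F^e$ is a $C^1$-diffeomorphism between neighbourhoods of $\hat K^e$ and $K^e$. Put $\phi^e_i=\hat\phi_i\circ(F^e)^{-1}$. Let $\Gamma^e_k$ be the faces of $K^e$, $\vec n^e$ the outward unit normal, and $\mathcal F_i$ the set of those $k$ for which the node $F^e(\hat x_i)$ lies on the closure of $\Gamma^e_k$ (all faces if $p=0$). Define $$m^e_{ij}=\int_{K^e}\phi^e_i\phi^e_j\,d\vec x,\qquad m^e_i=\sum_{j} m^e_{ij},\qquad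 \vec c^{\,e}_{ij}=\int_{K^e}\phi_i^e\nabla\phi_j^e\,d\vec x,$$ $M_C^e=(m^e_{ij})$, $M_L^e=\mathrm{diag}(m_i^e)$, let $C^e_k$ be the matrix of the $k$-th components of the vectors $\vec c^{\,e}_{ij}$, put $\tilde C^e_k=M_L^e(M_C^e)^{-1}C^e_k$ for $k=1,\dots,d$, and let $\tilde{\vec c}^{\,e}_{ij}\in\mathbb R^d$ be the vector of the $(i,j)$ entries of $\tilde C^e_1,\dots,\tilde C^e_d$. Let $\mathbf F:\mathbb R^m\to\mathbb R^{m\times d}$ be the flux of the conservation law, continuous on a set $D\subseteq\mathbb R^m$. Let $\lambda(U,V;\vec n)\in\mathbb R$ be any function of two states and a vector (in particular, any estimate of the maximal wave speed along $\vec n$). Let $u_j^e\in\mathbb R^m$ be coefficients such that $U_h^e=\sum_j u_j^e\phi_j^e$ has values in $D$ on $K^e$, and let $\dot u_j^e\in\mathbb R^m$ be any vectors (in particular, the nodal time derivatives given by the semi-discrete discontinuous Galerkin scheme). Put $\mathbf F_j^e=\mathbf F(u^e_j)$ and $$d^e_{ij}=\max\{|\tilde{\vec c}^{\,e}_{ij}|\lambda^e_{ij},\,|\tilde{\vec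 c}^{\,e}_{ji}|\lambda^e_{ji}\}\ (i\ne j),\qquad d^e_{ii}=-\sum_{k\ne i}d^e_{ik},\qquad \lambda_{ij}^e=\lambda\big(u_i^e,u_j^e;\tilde{\vec c}^{\,e}_{ij}/|\tilde{\vec c}^{\,e}_{ij}|\big),$$ where $|\tilde{\vec c}^{\,e}_{ij}|\lambda^e_{ij}$ is read as $0$ if $\tilde{\vec c}^{\,e}_{ij}=0$. For a choice of stencils $\tilde{\mathcal N}_i\subseteq\{1,\dots,N\}$, define the volumetric antidiffusive fluxes $$f_i^e=\sum_{j=1}^N(m_i^e\delta_{ij}-m_{ij}^e)\dot u_j^e-\sum_{j\in\tilde{\mathcal N}_i}\big[d^e_{ij}(u_j^e-u_i^e)-(\mathbf F_j^e-\mathbf F_i^e)\tilde{\vec c}^{\,e}_{ij}\big]+\int_{K^e}\mathbf F(U_h^e)\nabla\phi_i^e\,d\vec x-\sum_{k\in\mathcal F_i}\int_{\Gamma_k^e}\phi_i^e\,\mathbf F_i^e\,\vec n^e\,ds .$$ Then, for every $e\in\{1,\dots,E\}$, $\sum_{i=1}^N f_i^e=0$ holds (a) with the full stencils $\tilde{\mathcal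 N}_i=\{1,\dots,N\}$; (b) if the Jacobian of $F^e$ is constant on $\hat K^e$, also with the compact stencils $\tilde{\mathcal N}_i$ that consist of $i$ and the nearest neighbours of $i$ in the element: those $j$ such that, in every block of coordinates, the barycentric multi-indices of $j$ and $i$ agree or differ by moving one unit from one entry to another. -/

import Mathlib

open MeasureTheory
open scoped Matrix

noncomputable section

namespace BernsteinDG

/-- Euclidean space `ℝᵈ`. -/
abbrev Vec (d : ℕ) : Type := EuclideanSpace ℝ (Fin d)

/- Throughout the space dimension is `d = n + 1`.  A reference element is given by a partition of
the `d` coordinates into blocks, `block l` being the label of the block of coordinate `l`, and it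
is the product of the unit simplices in the blocks of coordinates.  One single block is the unit
simplex (line, triangle, tetrahedron), blocks with one coordinate each give the unit box (line,
square, cube), and two blocks with two and one coordinates give the prism. -/

section Reference

variable {n : ℕ} (block : Fin (n + 1) → Fin (n + 1))

/-- The faces of the reference element: `x_l = 0` for a coordinate `l`, and
`∑_{l in block r} x_l = 1` for a block `r`. -/
abbrev Face : Type := Fin (n + 1) ⊕ {r : Fin (n + 1) // ∃ l, block l = r}

/-- The affine function which vanishes on a face and is nonnegative on the reference element;
these are the barycentric coordinates of the simplices whose product the element is. -/
def bary : Face block → Vec (n + 1) → ℝ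
  | Sum.inl l, x => x l
  | Sum.inr r, x => 1 - ∑ l with block l = r.1, x l

/-- The (closed) reference element. -/
def refElement : Set (Vec (n + 1)) := {x | ∀ k : Face block, 0 ≤ bary block k x}

/-- The local indices of degree `p`: multi-indices `α` whose sum over each block is at most `p`. -/
abbrev Node (p : ℕ) : Type :=
  {α : Fin (n + 1) → Fin (p + 1) // ∀ r, ∑ l with block l = r, (α l : ℕ) ≤ p}

variable {block} {p : ℕ}

/-- The sum of the entries of a multi-index over a block. -/
def Node.blockSum (α : Node block p) (r : Fin (n + 1)) : ℕ := ∑ l with block l = r, (α.1 l : ℕ)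

/-- The Bernstein polynomials of degree `p` on the reference element: products over the blocks of
the Bernstein polynomials of degree `p` on the simplices. -/
def refBasis (α : Node block p) (x : Vec (n + 1)) : ℝ :=
  ∏ r, (p.factorial : ℝ) /
      (((∏ l with block l = r, (α.1 l : ℕ).factorial : ℕ) : ℝ) * ((p - α.blockSum r).factorial : ℝ))
    * (∏ l with block l = r, x l ^ (α.1 l : ℕ))
    * (1 - ∑ l with block l = r, x l) ^ (p - α.blockSum r)

/-- The nodes `α / p` on the reference element, for `p ≥ 1`. -/
def refNode (α : Node block p) : Vec (n + 1) := WithLp.toLp 2 fun l => ((α.1 l : ℕ) : ℝ) / (p : ℝ)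

/-- `NodeOnFace α k`: the node of `α` lies on the face `k`.  For `p = 0` the only basis function is
the constant `1`, and its index belongs to all faces. -/
def NodeOnFace (α : Node block p) (k : Face block) : Prop := p = 0 ∨ bary block k (refNode α) = 0

/-- The nearest neighbours of `α` within the element, `α` included: within each block the
barycentric multi-indices (the entries in the block together with `p` minus their sum) agree or
differ by moving one unit from one entry to another. -/
def nearestNeighbors (α : Node block p) : Finset (Node block p) :=
  {β | ∀ r, ∑ l with block l = r, |((α.1 l : ℕ) : ℤ) - ((β.1 l : ℕ) : ℤ)|
      + |(α.blockSum r : ℤ) - (β.blockSum r : ℤ)| ≤ 2}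

variable (block)

/-- A parametrization of the hyperplane of a face: all coordinates but one are free, and this one
(the coordinate `l` for the face `x_l = 0`, some coordinate of the block `r` for the face
`∑_{l in block r} x_l = 1`) is determined by the others. -/
def faceParam : Face block → Vec n → Vec (n + 1)
  | Sum.inl l, s => WithLp.toLp 2 (l.insertNth (α := fun _ => ℝ) 0 fun a => s a)
  | Sum.inr r, s => WithLp.toLp 2 (r.2.choose.insertNth (α := fun _ => ℝ)
      (1 - ∑ a with block (r.2.choose.succAbove a) = r.1, s a) fun a => s a)

end Reference

/-- An element: the image of a reference element under a `C¹` mapping with a `C¹` inverse, both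
given on neighbourhoods. -/
structure Element (n : ℕ) where
  /-- The shape of the reference element. -/
  block : Fin (n + 1) → Fin (n + 1)
  /-- The mapping from the reference element. -/
  map : OpenPartialHomeomorph (Vec (n + 1)) (Vec (n + 1))
  subset_source : refElement block ⊆ map.source
  contDiffOn_map : ContDiffOn ℝ 1 map map.source
  contDiffOn_symm : ContDiffOn ℝ 1 map.symm map.target

namespace Element

variable {n : ℕ} (K : Element n) {p : ℕ}

/-- The element as a subset of `ℝᵈ`. -/
def carrier : Set (Vec (n + 1)) := K.map '' refElement K.block

/-- The Jacobian of the element mapping is constant on the reference element. -/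
def ConstantJacobian : Prop :=
  ∀ x ∈ refElement K.block, ∀ y ∈ refElement K.block, fderiv ℝ K.map x = fderiv ℝ K.map y

/-- The Bernstein basis functions on the element. -/
def basis (i : Node K.block p) (x : Vec (n + 1)) : ℝ := refBasis i (K.map.symm x)

/-- The parametrization of a face of the element. -/
def param (k : Face K.block) (s : Vec n) : Vec (n + 1) := K.map (faceParam K.block k s)

/-- The area element (square root of the Gram determinant) of the parametrization of a face. -/
def areaElement (k : Face K.block) (s : Vec n) : ℝ :=
  Real.sqrt (Matrix.det (Matrix.of fun a b : Fin n =>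
    inner ℝ (fderiv ℝ (K.param k) s (EuclideanSpace.single a 1))
      (fderiv ℝ (K.param k) s (EuclideanSpace.single b 1))))

/-- The surface integral over a face of the element. -/
def faceIntegral {V : Type*} [NormedAddCommGroup V] [NormedSpace ℝ V] (k : Face K.block)
    (g : Vec (n + 1) → V) : V :=
  ∫ s in {s : Vec n | faceParam K.block k s ∈ refElement K.block},
    K.areaElement k s • g (K.param k s)

/-- The outward unit normal on a face: the element lies where the pulled back barycentric
coordinate of the face is nonnegative. -/
def normal (k : Face K.block) (x : Vec (n + 1)) : Vec (n + 1) :=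
  -(‖gradient (fun y => bary K.block k (K.map.symm y)) x‖⁻¹ •
    gradient (fun y => bary K.block k (K.map.symm y)) x)

variable (p)

/-- The consistent mass matrix `m_{ij} = ∫_K φ_i φ_j`. -/
def massMatrix : Matrix (Node K.block p) (Node K.block p) ℝ :=
  Matrix.of fun i j => ∫ x in K.carrier, K.basis i x * K.basis j x

/-- The diagonal entries `m_i = ∑_j m_{ij}` of the lumped mass matrix. -/
def lumpedMass (i : Node K.block p) : ℝ := ∑ j, K.massMatrix p i j

/-- The `k`-th component of the discrete gradient, with entries the `k`-th components of
`c_{ij} = ∫_K φ_i ∇ φ_j`. -/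
def gradMatrix (k : Fin (n + 1)) : Matrix (Node K.block p) (Node K.block p) ℝ :=
  Matrix.of fun i j => (∫ x in K.carrier, K.basis i x • gradient (K.basis j) x) k

/-- The preconditioned matrices `C̃_k = M_L M_C⁻¹ C_k`. -/
def precGradMatrix (k : Fin (n + 1)) : Matrix (Node K.block p) (Node K.block p) ℝ :=
  Matrix.diagonal (K.lumpedMass p) * (K.massMatrix p)⁻¹ * K.gradMatrix p k

variable {p}

/-- The vectors `c̃_{ij}`. -/
def precGrad (i j : Node K.block p) : Vec (n + 1) :=
  WithLp.toLp 2 fun k => K.precGradMatrix p k i j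

variable {m : ℕ}

/-- The numerical solution `U_h = ∑_j u_j φ_j` on the element. -/
def solution (u : Node K.block p → Fin m → ℝ) (x : Vec (n + 1)) : Fin m → ℝ :=
  ∑ j, K.basis j x • u j

/-- The numbers `|c̃_{ij}| λ(u_i, u_j; c̃_{ij} / |c̃_{ij}|)`. -/
def viscosity (lam : (Fin m → ℝ) → (Fin m → ℝ) → Vec (n + 1) → ℝ)
    (u : Node K.block p → Fin m → ℝ) (i j : Node K.block p) : ℝ :=
  ‖K.precGrad i j‖ * lam (u i) (u j) (‖K.precGrad i j‖⁻¹ • K.precGrad i j)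

/-- The dissipative matrix `d_{ij}`. -/
def dissipation (lam : (Fin m → ℝ) → (Fin m → ℝ) → Vec (n + 1) → ℝ)
    (u : Node K.block p → Fin m → ℝ) (i j : Node K.block p) : ℝ :=
  if i = j then
    -∑ k with k ≠ i, max (K.viscosity lam u i k) (K.viscosity lam u k i)
  else max (K.viscosity lam u i j) (K.viscosity lam u j i)

open Classical in
/-- The volumetric antidiffusive flux `f_i` of the element.  `F` is the flux of the conservation
law, `lam` the estimate of the wave speed, `u` the coefficients of the numerical solution, `udot`
their time derivatives, and `S i` the stencil of node `i`. -/
def antidiffusiveFlux (F : (Fin m → ℝ) → Matrix (Fin m) (Fin (n + 1)) ℝ)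
    (lam : (Fin m → ℝ) → (Fin m → ℝ) → Vec (n + 1) → ℝ)
    (S : Node K.block p → Finset (Node K.block p))
    (u udot : Node K.block p → Fin m → ℝ) (i : Node K.block p) : Fin m → ℝ :=
  (∑ j, ((if i = j then K.lumpedMass p i else 0) - K.massMatrix p i j) • udot j)
    - (∑ j ∈ S i,
        (K.dissipation lam u i j • (u j - u i) - (F (u j) - F (u i)) *ᵥ ⇑(K.precGrad i j)))
    + (∫ x in K.carrier, F (K.solution u x) *ᵥ ⇑(gradient (K.basis i) x))
    - (∑ k with NodeOnFace i k,
        K.faceIntegral k fun x => K.basis i x • (F (u i) *ᵥ ⇑(K.normal k x)))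

end Element

end BernsteinDG

end

/-! Summed over the nodes of one element, the terms of the flux cancel in groups. The mass terms
vanish because `M_C` is symmetric, so its column sums are also the lumped masses. The dissipative
terms vanish because `d_{ij}` is symmetric and `u_j - u_i` antisymmetric. The volume integrals
vanish because the basis is a partition of unity, so its gradients sum to zero.

There remain the terms in `c̃_{ij}` and the surface integrals. The rows of `c̃` sum to zero, and `1ᵀ
M_L M_C⁻¹ = 1ᵀ` gives the column sums `∫ ∇φ_j`; hence `∑_{ij} (F_j - F_i) c̃_{ij} = ∑_j F_j ∫ ∇φ_j`
(`sum_flux_mulVec_precGrad`). In the surface terms `F_i` is constant and `φ_i` vanishes on the faces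
that do not contain its node, so the divergence theorem turns them into `F_i ∫ ∇φ_i`, with the
opposite sign (`sum_faceIntegral_basis`). This uses that `M_C` is invertible, that is, that the
Bernstein polynomials are linearly independent.

The divergence theorem on a curved element (`integral_gradient_eq_sum_faceIntegral`) comes from `∫
∇(χ_N φ) = 0` for smooth cutoffs `χ_N` tending to the indicator of the element: `∇χ_N` is a sum of
layers, one per face, each of which concentrates to a surface integral.

For the compact stencils, a constant Jacobian makes the components of `∇φ_j` combinations of
Bernstein polynomials at nearest neighbours of `j`. Since `M_C⁻¹ C_k` is the matrix of their
coefficients, `c̃_{ij} = 0` off the stencil, and the compact fluxes equal the full ones. -/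

noncomputable section

namespace BernsteinDG

/-! ### Bernstein polynomials on the reference element -/

section Bernstein

variable {n : ℕ} {block : Fin (n + 1) → Fin (n + 1)} {p : ℕ}

variable (block) in
/-- The block to which a barycentric coordinate belongs. -/
def coordBlock : Fin (n + 1) ⊕ Fin (n + 1) → Fin (n + 1) := Sum.elim block id

variable (block) in
/-- All barycentric coordinates, those of the empty blocks included. -/
def bcoord (k : Fin (n + 1) ⊕ Fin (n + 1)) (x : Vec (n + 1)) : ℝ :=
  Sum.elim (fun l => x l) (fun r => 1 - ∑ l with block l = r, x l) k

/-- The barycentric multi-index of a node. -/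
def Node.exponent (α : Node block p) : Fin (n + 1) ⊕ Fin (n + 1) → ℕ :=
  Sum.elim (fun l => (α.1 l : ℕ)) (fun r => p - α.blockSum r)

theorem Node.blockSum_le (α : Node block p) (r : Fin (n + 1)) : α.blockSum r ≤ p := α.2 r

theorem sum_coordBlock {M : Type*} [AddCommMonoid M] (f : Fin (n + 1) ⊕ Fin (n + 1) → M)
    (r : Fin (n + 1)) :
    ∑ k with coordBlock block k = r, f k = (∑ l with block l = r, f (Sum.inl l)) + f (Sum.inr r) := by
  rw [Finset.sum_filter, Finset.sum_filter, Fintype.sum_sum_type]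
  refine congrArg₂ (· + ·) rfl ?_
  rw [Finset.sum_eq_single r] <;> simp +contextual [coordBlock]

theorem sum_bcoord (r : Fin (n + 1)) (x : Vec (n + 1)) :
    ∑ k with coordBlock block k = r, bcoord block k x = 1 := by
  simp [sum_coordBlock, bcoord]

theorem Node.sum_exponent (α : Node block p) (r : Fin (n + 1)) :
    ∑ k with coordBlock block k = r, α.exponent k = p := by
  have := α.blockSum_le r
  rw [sum_coordBlock]
  simp only [Node.exponent, Sum.elim_inl, Sum.elim_inr]
  change α.blockSum r + _ = p
  omega

/-- The converse of `Node.sum_exponent`: it allows a neighbouring node to be produced by shifting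
exponents. -/
theorem exists_node_exponent_eq {e : Fin (n + 1) ⊕ Fin (n + 1) → ℕ}
    (he : ∀ r, ∑ k with coordBlock block k = r, e k = p) : ∃ β : Node block p, β.exponent = e := by
  simp only [sum_coordBlock] at he
  have h1 : ∀ l, e (Sum.inl l) < p + 1 := fun l => by
    have := he (block l)
    have h2 := Finset.single_le_sum (f := fun l => e (Sum.inl l))
      (s := Finset.univ.filter fun a => block a = block l) (fun _ _ => Nat.zero_le _)
      (Finset.mem_filter.2 ⟨Finset.mem_univ l, rfl⟩)
    omega
  refine ⟨⟨fun l => ⟨e (Sum.inl l), h1 l⟩, fun r => ?_⟩, ?_⟩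
  · exact (Nat.le_add_right _ _).trans (he r).le
  · funext k
    rcases k with l | r
    · rfl
    · have := he r
      simp only [Node.exponent, Sum.elim_inr, Node.blockSum]
      omega

/-- The coefficient of the Bernstein polynomial. -/
def Node.coeff (α : Node block p) : ℝ :=
  ∏ r, (p.factorial : ℝ) /
      (((∏ l with block l = r, (α.1 l : ℕ).factorial : ℕ) : ℝ) * ((p - α.blockSum r).factorial : ℝ))

theorem Node.coeff_pos (α : Node block p) : 0 < α.coeff := by
  refine Finset.prod_pos fun r _ => ?_
  have h1 : 0 < ∏ l with block l = r, (α.1 l : ℕ).factorial :=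
    Finset.prod_pos fun l _ => Nat.factorial_pos _
  have h2 := Nat.factorial_pos p
  have h3 := Nat.factorial_pos (p - α.blockSum r)
  positivity

theorem refBasis_eq_coeff_mul (α : Node block p) (x : Vec (n + 1)) :
    refBasis α x = α.coeff * ∏ k, bcoord block k x ^ α.exponent k := by
  unfold refBasis Node.coeff
  rw [Finset.prod_mul_distrib, Finset.prod_mul_distrib, mul_assoc, Fintype.prod_sum_type]
  congr 2
  simp only [bcoord, Node.exponent, Sum.elim_inl]
  exact Finset.prod_fiberwise Finset.univ block _

theorem bary_eq_bcoord (k : Face block) (x : Vec (n + 1)) :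
    bary block k x = bcoord block (Sum.map id Subtype.val k) x := by
  rcases k with l | r <;> rfl

/-- A node off the face `k` has a positive exponent on the barycentric coordinate that vanishes
there. -/
theorem refBasis_eq_zero_of_not_nodeOnFace {α : Node block p} {k : Face block}
    (h : ¬ NodeOnFace α k) {x : Vec (n + 1)} (hx : bary block k x = 0) : refBasis α x = 0 := by
  rw [refBasis_eq_coeff_mul]
  refine mul_eq_zero_of_right _ (Finset.prod_eq_zero
    (Finset.mem_univ (Sum.map id Subtype.val k : Fin (n + 1) ⊕ Fin (n + 1))) ?_)
  rw [← bary_eq_bcoord, hx]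
  refine zero_pow fun h0 => h ?_
  by_cases hp : p = 0
  · exact Or.inl hp
  right
  have hp' : (p : ℝ) ≠ 0 := by exact_mod_cast hp
  rcases k with l | r
  · have : (α.1 l : ℕ) = 0 := h0
    simp [bary, refNode, this]
  · have h1 : p - α.blockSum r = 0 := h0
    have h2 : α.blockSum r = p := by have := α.blockSum_le r; omega
    simp only [bary, refNode]
    rw [← Finset.sum_div, ← Nat.cast_sum]
    change 1 - ((α.blockSum r : ℕ) : ℝ) / p = 0
    rw [h2, div_self hp', sub_self]

/-- In each block the multinomial theorem expands `(∑ barycentric coordinates) ^ p = 1`.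
Distributing the product of these expansions over the blocks gives one term per family of block
multi-indices, that is, per node. -/
theorem sum_refBasis (x : Vec (n + 1)) : ∑ α : Node block p, refBasis α x = 1 := by
  classical
  -- `none` stands for the last barycentric coordinate of the block; an empty block has only this
  -- one, equal to `1`.
  let s : Fin (n + 1) → Finset (Option (Fin (n + 1))) := fun r =>
    Finset.insertNone (Finset.univ.filter fun l => block l = r)
  let f : Fin (n + 1) → Option (Fin (n + 1)) → ℝ := fun r o =>
    o.elim (1 - ∑ l with block l = r, x l) (fun l => x l)
  have h1 : ∀ r, ∑ g ∈ (s r).piAntidiag p,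
      (Nat.multinomial (s r) g : ℝ) * ∏ i ∈ s r, f r i ^ g i = 1 := fun r => by
    rw [← Finset.sum_pow_eq_sum_piAntidiag, Finset.sum_insertNone]
    simp [f]
  have h2 : ∏ r, ∑ g ∈ (s r).piAntidiag p,
      (Nat.multinomial (s r) g : ℝ) * ∏ i ∈ s r, f r i ^ g i = 1 := by simp [h1]
  rw [Finset.prod_univ_sum] at h2
  rw [← h2]
  symm
  have mem : ∀ {G : Fin (n + 1) → Option (Fin (n + 1)) → ℕ},
      G ∈ Fintype.piFinset (fun r => (s r).piAntidiag p) →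
      ∀ r, (∑ l with block l = r, G r (some l)) + G r none = p ∧
        ∀ l, block l ≠ r → G r (some l) = 0 := fun {G} hG r => by
    have := Fintype.mem_piFinset.1 hG r
    rw [Finset.mem_piAntidiag, Finset.sum_insertNone] at this
    refine ⟨by rw [add_comm]; exact this.1, fun l hl => ?_⟩
    by_contra h
    exact hl (by simpa [s] using this.2 (some l) h)
  have fib : ∀ {G : Fin (n + 1) → Option (Fin (n + 1)) → ℕ} (r),
      ∑ l with block l = r, G (block l) (some l) = ∑ l with block l = r, G r (some l) :=
    fun {G} r => Finset.sum_congr rfl fun l hl => by rw [(Finset.mem_filter.1 hl).2]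
  have lt : ∀ {G : Fin (n + 1) → Option (Fin (n + 1)) → ℕ},
      G ∈ Fintype.piFinset (fun r => (s r).piAntidiag p) → ∀ l, G (block l) (some l) < p + 1 :=
    fun {G} hG l => by
    have h3 := (mem hG (block l)).1
    have h4 := Finset.single_le_sum (f := fun a => G (block l) (some a))
      (s := Finset.univ.filter fun a => block a = block l) (fun _ _ => Nat.zero_le _)
      (Finset.mem_filter.2 ⟨Finset.mem_univ l, rfl⟩)
    omega
  have le : ∀ {G : Fin (n + 1) → Option (Fin (n + 1)) → ℕ},
      G ∈ Fintype.piFinset (fun r => (s r).piAntidiag p) →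
      ∀ r, ∑ l with block l = r, G (block l) (some l) ≤ p := fun {G} hG r => by
    rw [fib]
    exact (Nat.le_add_right _ _).trans (mem hG r).1.le
  -- A node takes each coordinate `l` from the multi-index of the block of `l`; the inverse fills in
  -- zeros outside the block and the complement to `p` at `none`.
  refine Finset.sum_bij'
    (i := fun G hG =>
      (⟨fun l => ⟨G (block l) (some l), lt hG l⟩, le hG⟩ : Node block p))
    (j := fun α _ => fun r o =>
      o.elim (p - α.blockSum r) (fun l => if block l = r then (α.1 l : ℕ) else 0))
    (fun _ _ => Finset.mem_univ _) ?_ ?_ ?_ ?_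
  · intro α _
    refine Fintype.mem_piFinset.2 fun r => Finset.mem_piAntidiag.2 ⟨?_, ?_⟩
    · rw [Finset.sum_insertNone]
      have := α.blockSum_le r
      have h5 : ∑ l with block l = r, (if block l = r then (α.1 l : ℕ) else 0) = α.blockSum r :=
        Finset.sum_congr rfl fun l hl => by simp [(Finset.mem_filter.1 hl).2]
      simp only [Option.elim]
      rw [h5]
      omega
    · rintro (_ | l) h
      · simp [s]
      · simp only [Option.elim] at h
        simpa [s] using (ite_ne_right_iff.1 h).1
  · intro G hG
    funext r o
    rcases o with _ | l
    · have := (mem hG r).1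
      simp only [Option.elim, Node.blockSum, fib]
      omega
    · by_cases h : block l = r
      · simp [h]
      · simp [h, (mem hG r).2 l h]
  · intro α _
    apply Subtype.ext
    funext l
    simp
  · intro G hG
    unfold refBasis
    refine Finset.prod_congr rfl fun r _ => ?_
    have h6 := (mem hG r).1
    have h7 : p - Node.blockSum (⟨fun l => ⟨G (block l) (some l), lt hG l⟩, le hG⟩ : Node block p) r = G r none := by
      simp only [Node.blockSum, fib]
      omega
    have h8 : (Nat.multinomial (s r) (G r) : ℝ) = (p.factorial : ℝ) /
        (((∏ l with block l = r, (G r (some l)).factorial : ℕ) : ℝ) *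
          ((G r none).factorial : ℝ)) := by
      have h9 := Nat.multinomial_spec (s r) (G r)
      rw [Finset.prod_insertNone, Finset.sum_insertNone, add_comm (G r none), h6] at h9
      rw [← h9]
      have : (∏ l with block l = r, (G r (some l)).factorial : ℕ) ≠ 0 :=
        Finset.prod_ne_zero_iff.2 fun l _ => Nat.factorial_ne_zero _
      have h10 : ((∏ l with block l = r, (G r (some l)).factorial : ℕ) : ℝ) ≠ 0 := by
        exact_mod_cast this
      have h11 : ((G r none).factorial : ℝ) ≠ 0 := by exact_mod_cast Nat.factorial_ne_zero _
      rw [eq_div_iff (mul_ne_zero h10 h11), Nat.cast_mul, Nat.cast_mul]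
      ring
    have h12 : (∏ l with block l = r, (G (block l) (some l)).factorial) =
        ∏ l with block l = r, (G r (some l)).factorial :=
      Finset.prod_congr rfl fun l hl => by rw [(Finset.mem_filter.1 hl).2]
    have h13 : (∏ l with block l = r, x l ^ (G (block l) (some l))) =
        ∏ l with block l = r, x l ^ (G r (some l)) :=
      Finset.prod_congr rfl fun l hl => by rw [(Finset.mem_filter.1 hl).2]
    rw [h7, h8, Finset.prod_insertNone]
    simp only [h12, h13, f, Option.elim]
    ring

theorem contDiff_bcoord (k : Fin (n + 1) ⊕ Fin (n + 1)) : ContDiff ℝ 1 (bcoord block k) := by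
  have h : ∀ l, ContDiff ℝ 1 fun x : Vec (n + 1) => x l := fun l =>
    (EuclideanSpace.proj (𝕜 := ℝ) l).contDiff
  rcases k with l | r
  · exact h l
  · exact contDiff_const.sub (ContDiff.sum fun l _ => h l)

variable (block) in
/-- The derivative of a barycentric coordinate, which is constant. -/
def bcoordDeriv (k : Fin (n + 1) ⊕ Fin (n + 1)) : Vec (n + 1) →L[ℝ] ℝ :=
  Sum.elim (fun l => EuclideanSpace.proj (𝕜 := ℝ) l)
    (fun r => -∑ l with block l = r, EuclideanSpace.proj (𝕜 := ℝ) l) k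

theorem hasFDerivAt_bcoord (k : Fin (n + 1) ⊕ Fin (n + 1)) (x : Vec (n + 1)) :
    HasFDerivAt (bcoord block k) (bcoordDeriv block k) x := by
  have h : ∀ l, HasFDerivAt (fun x : Vec (n + 1) => x l) (EuclideanSpace.proj (𝕜 := ℝ) l) x :=
    fun l => (EuclideanSpace.proj (𝕜 := ℝ) l).hasFDerivAt
  rcases k with l | r
  · exact h l
  · exact (HasFDerivAt.fun_sum fun l _ => h l).const_sub 1

theorem contDiff_refBasis (α : Node block p) : ContDiff ℝ 1 (refBasis α) := by
  have : refBasis α = fun x => α.coeff * ∏ k, bcoord block k x ^ α.exponent k :=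
    funext (refBasis_eq_coeff_mul α)
  rw [this]
  exact contDiff_const.mul (contDiff_prod fun k _ => (contDiff_bcoord k).pow _)

theorem prod_bcoord_mem_span {S : Set (Node block p)} {β : Node block p} (hβ : β ∈ S) :
    (fun x => ∏ k, bcoord block k x ^ β.exponent k) ∈
      Submodule.span ℝ ((fun γ : Node block p => (refBasis γ : Vec (n + 1) → ℝ)) '' S) := by
  have : (fun x => ∏ k, bcoord block k x ^ β.exponent k) = β.coeff⁻¹ • refBasis β := by
    funext x
    simp [refBasis_eq_coeff_mul, β.coeff_pos.ne']
  rw [this]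
  exact Submodule.smul_mem _ _ (Submodule.subset_span ⟨β, hβ, rfl⟩)

theorem mem_nearestNeighbors_iff {α β : Node block p} : β ∈ nearestNeighbors α ↔
    ∀ r, ∑ k with coordBlock block k = r, |(α.exponent k : ℤ) - β.exponent k| ≤ 2 := by
  simp only [nearestNeighbors, Finset.mem_filter, Finset.mem_univ, true_and]
  refine forall_congr' fun r => ?_
  rw [sum_coordBlock]
  simp only [Node.exponent, Sum.elim_inl, Sum.elim_inr, Nat.cast_sub (Node.blockSum_le _ r)]
  rw [sub_sub_sub_cancel_left, abs_sub_comm (β.blockSum r : ℤ)]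

theorem mem_nearestNeighbors_comm {α β : Node block p} :
    β ∈ nearestNeighbors α ↔ α ∈ nearestNeighbors β := by
  simp only [mem_nearestNeighbors_iff, abs_sub_comm]

/-- Differentiating the factor of the coordinate `k` lowers its exponent by one. Multiplying by `∑
bcoord = 1` over the block of `k` restores the degree `p` and yields monomials in which one unit has
moved from `k` to some `k'` of the same block. -/
theorem fderiv_refBasis_mem_span (α : Node block p) (v : Vec (n + 1)) :
    (fun x => fderiv ℝ (refBasis α) x v) ∈ Submodule.span ℝ
      ((fun γ : Node block p => (refBasis γ : Vec (n + 1) → ℝ)) ''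
        {β | α ∈ nearestNeighbors β}) := by
  classical
  have hd : ∀ x, fderiv ℝ (refBasis α) x v = ∑ k, (α.coeff * α.exponent k * bcoordDeriv block k v) *
      ((∏ i ∈ Finset.univ.erase k, bcoord block i x ^ α.exponent i) *
        bcoord block k x ^ (α.exponent k - 1)) := fun x => by
    have h1 : HasFDerivAt (refBasis α) _ x :=
      ((HasFDerivAt.finsetProd (u := Finset.univ) fun k _ =>
        ((hasFDerivAt_bcoord (block := block) k x).pow (α.exponent k))).const_mul
          α.coeff).congr_of_eventuallyEq
        (Filter.Eventually.of_forall (refBasis_eq_coeff_mul α))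
    rw [h1.fderiv]
    simp only [_root_.smul_apply, _root_.sum_apply, smul_eq_mul,
      Finset.mul_sum, nsmul_eq_mul]
    refine Finset.sum_congr rfl fun k _ => ?_
    ring
  have hd' : (fun x => fderiv ℝ (refBasis α) x v) =
      ∑ k, (α.coeff * α.exponent k * bcoordDeriv block k v) • (fun x =>
      ((∏ i ∈ Finset.univ.erase k, bcoord block i x ^ α.exponent i) *
        bcoord block k x ^ (α.exponent k - 1))) := by
    funext x
    simp [hd, Finset.sum_apply]
  rw [hd']
  refine Submodule.sum_mem _ fun k _ => ?_
  by_cases h0 : α.exponent k = 0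
  · simp [h0]
  refine Submodule.smul_mem _ _ ?_
  -- The exponents of `α` with one unit moved from `k` to `k'`; `k' = k` gives `α` back.
  let E : Fin (n + 1) ⊕ Fin (n + 1) → Fin (n + 1) ⊕ Fin (n + 1) → ℕ := fun k' i =>
    Function.update α.exponent k (α.exponent k - 1) i + (Pi.single k' 1 : _ → ℕ) i
  have hx : (fun x => ((∏ i ∈ Finset.univ.erase k, bcoord block i x ^ α.exponent i) *
        bcoord block k x ^ (α.exponent k - 1))) =
      ∑ k' with coordBlock block k' = coordBlock block k, (fun x =>
        ∏ i, bcoord block i x ^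
          E k' i) := by
    funext x
    have h2 : ∀ k', ∏ i, bcoord block i x ^
          E k' i =
        ((∏ i ∈ Finset.univ.erase k, bcoord block i x ^ α.exponent i) *
        bcoord block k x ^ (α.exponent k - 1)) * bcoord block k' x := fun k' => by
      simp only [E, pow_add, Finset.prod_mul_distrib]
      congr 1
      · rw [← Finset.prod_erase_mul _ _ (Finset.mem_univ k)]
        congr 1
        · refine Finset.prod_congr rfl fun i hi => ?_
          rw [Function.update_of_ne (Finset.ne_of_mem_erase hi)]
        · rw [Function.update_self]
      · rw [Finset.prod_eq_single k']
        · simp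
        · intro b _ hb
          simp [Pi.single_eq_of_ne hb]
        · simp
    rw [Finset.sum_apply]
    simp only [h2]
    rw [← Finset.mul_sum, sum_bcoord, mul_one]
  rw [hx]
  refine Submodule.sum_mem _ fun k' hk' => ?_
  have hk' := (Finset.mem_filter.1 hk').2
  -- The additive form of the move is free of truncated subtraction and is all that is needed of `E`
  -- from here on.
  have key : ∀ i, E k' i +
      (Pi.single k 1 : _ → ℕ) i = α.exponent i + (Pi.single k' 1 : _ → ℕ) i := fun i => by
    by_cases hi : i = k
    · subst hi
      simp only [E, Function.update_self, Pi.single_eq_same]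
      omega
    · simp [E, Function.update_of_ne hi, Pi.single_eq_of_ne hi]
  have single : ∀ (j : Fin (n + 1) ⊕ Fin (n + 1)) (r),
      ∑ i with coordBlock block i = r, (Pi.single j 1 : _ → ℕ) i =
        if coordBlock block j = r then 1 else 0 := fun j r => by
    rw [Finset.sum_filter, Finset.sum_eq_single j]
    · simp
    · intro b _ hb
      simp [Pi.single_eq_of_ne hb]
    · simp
  clear_value E
  obtain ⟨β, hβ⟩ := exists_node_exponent_eq (block := block) (p := p)
    (e := E k') fun r => by
      have h3 := Finset.sum_congr (rfl : (Finset.univ.filter fun i => coordBlock block i = r) = _)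
        fun i _ => key i
      rw [Finset.sum_add_distrib, Finset.sum_add_distrib, single, single, hk',
        α.sum_exponent] at h3
      omega
  rw [← hβ]
  refine prod_bcoord_mem_span ?_
  rw [Set.mem_ofPred_eq, mem_nearestNeighbors_iff]
  intro r
  have h4 : ∀ i, |(β.exponent i : ℤ) - α.exponent i| ≤
      (((Pi.single k 1 : _ → ℕ) i + (Pi.single k' 1 : _ → ℕ) i : ℕ) : ℤ) := fun i => by
    have := key i
    rw [← hβ] at this
    rw [abs_le]
    constructor <;> push_cast <;> omega
  refine (Finset.sum_le_sum fun i _ => h4 i).trans ?_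
  rw [← Nat.cast_sum, Finset.sum_add_distrib, single, single]
  split_ifs <;> norm_num

/-- In projective coordinates the Bernstein polynomials become distinct monomials times a common
nonzero factor, so a vanishing combination is a polynomial that vanishes on the positive orthant.
Interior points suffice, which is what an almost everywhere argument will supply. -/
theorem refBasis_coeff_eq_zero {c : Node block p → ℝ}
    (h : ∀ x : Vec (n + 1), (∀ k, 0 < bcoord block k x) → ∑ α, c α * refBasis α x = 0) :
    c = 0 := by
  classical
  let P : MvPolynomial (Fin (n + 1)) ℝ :=
    ∑ α : Node block p, MvPolynomial.monomial (Finsupp.equivFunOnFinite.symm fun l => (α.1 l : ℕ))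
      (c α * α.coeff)
  have hP : P = 0 := by
    refine MvPolynomial.funext_set (fun _ => Set.Ioi 0) (fun _ => Set.Ioi_infinite 0) fun y hy => ?_
    have hy : ∀ l, 0 < y l := fun l => hy l (Set.mem_univ l)
    let s : Fin (n + 1) → ℝ := fun r => 1 + ∑ l with block l = r, y l
    have hs : ∀ r, 0 < s r := fun r => by
      have := Finset.sum_nonneg fun l (_ : l ∈ Finset.univ.filter fun a => block a = r) => (hy l).le
      simp only [s]
      linarith
    -- With this choice `y l` is the ratio of the coordinate `l` to the last barycentric coordinate
    -- of its block, which equals `1 / s`.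
    let x : Vec (n + 1) := WithLp.toLp 2 fun l => y l / s (block l)
    have hl : ∀ l, bcoord block (Sum.inl l) x = y l / s (block l) := fun l => rfl
    have hr : ∀ r, bcoord block (Sum.inr r) x = 1 / s r := fun r => by
      have : ∑ l with block l = r, y l / s (block l) = (s r - 1) / s r := by
        have h1 : s r - 1 = ∑ l with block l = r, y l := by simp [s]
        rw [h1, Finset.sum_div]
        exact Finset.sum_congr rfl fun l hl => by rw [(Finset.mem_filter.1 hl).2]
      change 1 - ∑ l with block l = r, y l / s (block l) = _
      rw [this]
      have := (hs r).ne'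
      field_simp
      ring
    have h2 := h x (by
      rintro (l | r)
      · rw [hl]; exact div_pos (hy l) (hs _)
      · rw [hr]; exact div_pos one_pos (hs _))
    have h3 : ∀ α : Node block p, refBasis α x =
        α.coeff * (∏ l, y l ^ (α.1 l : ℕ)) * ∏ r, (s r)⁻¹ ^ p := fun α => by
      rw [refBasis_eq_coeff_mul, Fintype.prod_sum_type, mul_assoc]
      congr 1
      simp only [hl, hr, Node.exponent, Sum.elim_inl, Sum.elim_inr,
        div_eq_mul_inv, Finset.prod_mul_distrib, one_mul, mul_pow]
      rw [mul_assoc]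
      congr 1
      rw [← Finset.prod_fiberwise Finset.univ block, ← Finset.prod_mul_distrib]
      refine Finset.prod_congr rfl fun r _ => ?_
      have h4 : ∏ l with block l = r, (s (block l))⁻¹ ^ (α.1 l : ℕ) =
          (s r)⁻¹ ^ (α.blockSum r) := by
        rw [Node.blockSum, ← Finset.prod_pow_eq_pow_sum]
        exact Finset.prod_congr rfl fun l hl => by rw [(Finset.mem_filter.1 hl).2]
      rw [h4, ← pow_add, Nat.add_sub_cancel' (α.blockSum_le r)]
    have h5 : ∏ r, (s r)⁻¹ ^ p ≠ 0 :=
      Finset.prod_ne_zero_iff.2 fun r _ => pow_ne_zero _ (inv_ne_zero (hs r).ne')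
    simp only [h3, ← mul_assoc] at h2
    rw [← Finset.sum_mul] at h2
    have h6 := (mul_eq_zero.1 h2).resolve_right h5
    simp only [P, map_sum, MvPolynomial.eval_monomial, map_zero]
    rw [← h6]
    refine Finset.sum_congr rfl fun α _ => ?_
    rw [Finsupp.prod_fintype _ _ (fun _ => pow_zero _)]
    rfl
  funext α
  have h7 : P.coeff (Finsupp.equivFunOnFinite.symm fun l => (α.1 l : ℕ)) = c α * α.coeff := by
    simp only [P, MvPolynomial.coeff_sum, MvPolynomial.coeff_monomial]
    rw [Finset.sum_eq_single α]
    · simp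
    · intro β _ hβ
      rw [if_neg]
      intro h
      refine hβ (Subtype.ext (funext fun l => Fin.ext ?_))
      exact congrFun (Finsupp.equivFunOnFinite.symm.injective h) l
    · simp
  rw [hP, MvPolynomial.coeff_zero] at h7
  exact (mul_eq_zero.1 h7.symm).resolve_right α.coeff_pos.ne'

end Bernstein

/-! ### Geometry of the reference element and its faces -/

open Filter Topology

/-- The zero set is empty or a proper affine subspace. It is applied both in the element and in the
parameter space of a face. -/
theorem volume_affine_zeroSet {E : Type*} [NormedAddCommGroup E] [NormedSpace ℝ E]
    [MeasurableSpace E] [BorelSpace E] [FiniteDimensional ℝ E] (μ : Measure E) [μ.IsAddHaarMeasure]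
    {f : E → ℝ} {c : ℝ} {D : E →L[ℝ] ℝ} (hf : ∀ x, f x = c + D x) {x₀ : E} (hx₀ : f x₀ ≠ 0) :
    μ {x | f x = 0} = 0 := by
  by_cases hex : ∃ x₁, f x₁ = 0
  · obtain ⟨x₁, hx₁⟩ := hex
    have hset : {x | f x = 0} = (AffineSubspace.mk' x₁ (LinearMap.ker D.toLinearMap) : Set E) := by
      ext x
      rw [SetLike.mem_coe, AffineSubspace.mem_mk', LinearMap.mem_ker]
      have h1 := hf x
      have h2 := hf x₁
      simp only [vsub_eq_sub, ContinuousLinearMap.coe_coe, map_sub]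
      constructor
      · intro (h : f x = 0); linarith
      · intro h; change f x = 0; linarith
    rw [hset]
    refine Measure.addHaar_affineSubspace μ _ fun htop => hx₀ ?_
    have : x₀ ∈ (AffineSubspace.mk' x₁ (LinearMap.ker D.toLinearMap) : Set E) := by
      rw [htop]; trivial
    rw [← hset] at this
    exact this
  · push Not at hex
    have : {x | f x = 0} = ∅ := Set.eq_empty_iff_forall_notMem.2 fun x hx => hex x hx
    rw [this, measure_empty]

section Geometry

variable {n : ℕ} {block : Fin (n + 1) → Fin (n + 1)}

variable (block) in
/-- The derivative of the barycentric coordinate of a face. -/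
def baryDeriv (k : Face block) : Vec (n + 1) →L[ℝ] ℝ := bcoordDeriv block (Sum.map id Subtype.val k)

theorem bary_eq_add (k : Face block) (x : Vec (n + 1)) :
    bary block k x = bary block k 0 + baryDeriv block k x := by
  rcases k with l | r
  · simp [bary, baryDeriv, bcoordDeriv]
  · simp [bary, baryDeriv, bcoordDeriv]
    ring

theorem hasFDerivAt_bary (k : Face block) (x : Vec (n + 1)) :
    HasFDerivAt (bary block k) (baryDeriv block k) x := by
  rw [funext (bary_eq_bcoord k)]
  exact hasFDerivAt_bcoord _ x

theorem contDiff_bary (k : Face block) : ContDiff ℝ 1 (bary block k) := by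
  rw [funext (bary_eq_bcoord k)]
  exact contDiff_bcoord _

theorem continuous_bary (k : Face block) : Continuous (bary block k) := (contDiff_bary k).continuous

theorem isClosed_refElement : IsClosed (refElement block) := by
  have : refElement block = ⋂ k : Face block, {x | 0 ≤ bary block k x} := by
    ext x; simp [refElement]
  rw [this]
  exact isClosed_iInter fun k => isClosed_le continuous_const (continuous_bary k)

theorem refElement_coord_mem {x : Vec (n + 1)} (hx : x ∈ refElement block) (l : Fin (n + 1)) :
    x l ∈ Set.Icc (0 : ℝ) 1 := by
  refine ⟨hx (Sum.inl l), ?_⟩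
  have h1 : 0 ≤ 1 - ∑ a with block a = block l, x a := hx (Sum.inr ⟨block l, l, rfl⟩)
  have h2 := Finset.single_le_sum (f := fun a => x a)
    (s := Finset.univ.filter fun a => block a = block l) (fun a _ => hx (Sum.inl a))
    (Finset.mem_filter.2 ⟨Finset.mem_univ l, rfl⟩)
  linarith

theorem isCompact_unitBox (d : ℕ) : IsCompact {x : Vec d | ∀ l, x l ∈ Set.Icc (0 : ℝ) 1} := by
  have h := (isCompact_univ_pi fun _ : Fin d => isCompact_Icc (a := (0 : ℝ)) (b := 1)).image
    (PiLp.continuous_toLp 2 _)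
  refine h.of_isClosed_subset ?_ fun x hx => ⟨x.ofLp, fun l _ => hx l, rfl⟩
  simp only [Set.ofPred_forall]
  exact isClosed_iInter fun l => isClosed_Icc.preimage (EuclideanSpace.proj (𝕜 := ℝ) l).continuous

theorem isCompact_refElement : IsCompact (refElement block) :=
  (isCompact_unitBox _).of_isClosed_subset isClosed_refElement fun _ hx l =>
    refElement_coord_mem hx l

variable (block) in
/-- The open reference element. -/
def openRefElement : Set (Vec (n + 1)) := {x | ∀ k : Face block, 0 < bary block k x}

theorem openRefElement_subset : openRefElement block ⊆ refElement block := fun _ hx k => (hx k).le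

theorem isOpen_openRefElement : IsOpen (openRefElement block) := by
  have : openRefElement block = ⋂ k : Face block, {x | 0 < bary block k x} := by
    ext x; simp [openRefElement]
  rw [this]
  exact isOpen_iInter_of_finite fun k => isOpen_lt continuous_const (continuous_bary k)

theorem exists_bary_ne_zero (k : Face block) : ∃ x, bary block k x ≠ 0 := by
  rcases k with l | r
  · exact ⟨EuclideanSpace.single l 1, by simp [bary]⟩
  · exact ⟨0, by simp [bary]⟩

/-- The hyperplanes of different faces do not coincide, so a face meets the others in a null set of
its parameters (`ae_bary_faceParam_ne_zero`). -/
theorem exists_bary_eq_zero_ne_zero {k l : Face block} (hkl : l ≠ k) :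
    ∃ x, bary block k x = 0 ∧ bary block l x ≠ 0 := by
  rcases k with a | ⟨r, c, hc⟩
  · rcases l with b | r
    · have : a ≠ b := fun h => hkl (by rw [h])
      exact ⟨EuclideanSpace.single b 1, by simp [bary, this], by simp [bary]⟩
    · exact ⟨0, by simp [bary], by simp [bary]⟩
  · rcases l with b | ⟨r', h'⟩
    · have h0 : ((Finset.univ.filter fun l => block l = r).card : ℝ) ≠ 0 := by
        exact_mod_cast (Finset.card_pos.2 ⟨c, by simp [hc]⟩).ne'
      -- All coordinates equal the inverse size of the block: those of the block sum to one, and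
      -- none is zero.
      refine ⟨WithLp.toLp 2 fun _ => ((Finset.univ.filter fun l => block l = r).card : ℝ)⁻¹, ?_, ?_⟩
      · simp [bary, h0]
      · simp only [bary]
        exact inv_ne_zero h0
    · have hr : r ≠ r' := fun h => hkl (by simp [h])
      refine ⟨EuclideanSpace.single c 1, ?_, ?_⟩
      · simp only [bary, PiLp.single_apply, Finset.sum_ite_eq', Finset.mem_filter,
          Finset.mem_univ, true_and, hc, if_true, sub_self]
      · simp only [bary, PiLp.single_apply, Finset.sum_ite_eq', Finset.mem_filter,
          Finset.mem_univ, true_and, hc, hr, if_false, sub_zero]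
        exact one_ne_zero

theorem ae_mem_openRefElement :
    ∀ᵐ x : Vec (n + 1), x ∈ refElement block → x ∈ openRefElement block := by
  have h : ∀ k : Face block, ∀ᵐ x : Vec (n + 1), bary block k x ≠ 0 := fun k => by
    obtain ⟨x₀, hx₀⟩ := exists_bary_ne_zero k
    rw [ae_iff]
    simpa using volume_affine_zeroSet volume (bary_eq_add k) hx₀
  filter_upwards [ae_all_iff.2 h] with x hx hx' k
  exact lt_of_le_of_ne (hx' k) (hx k).symm

/-- The coordinate that the parametrization of a face determines by the others. -/
def facePivot : Face block → Fin (n + 1)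
  | Sum.inl l => l
  | Sum.inr r => r.2.choose

/-- The value of the determined coordinate in the parametrization of a face. -/
def faceOffset : Face block → Vec n → ℝ
  | Sum.inl _, _ => 0
  | Sum.inr r, s => 1 - ∑ a with block (r.2.choose.succAbove a) = r.1, s a

/-- The linear part of `faceOffset`. -/
def faceOffsetLin : Face block → Vec n → ℝ
  | Sum.inl _, _ => 0
  | Sum.inr r, s => - ∑ a with block (r.2.choose.succAbove a) = r.1, s a

/-- The sign of the determined coordinate in the barycentric coordinate of a face. -/
def faceSign : Face block → ℝ
  | Sum.inl _ => 1
  | Sum.inr _ => -1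

theorem faceParam_eq (k : Face block) (s : Vec n) : faceParam block k s =
    WithLp.toLp 2 ((facePivot k).insertNth (α := fun _ => ℝ) (faceOffset k s) fun a => s a) := by
  rcases k with l | r <;> rfl

theorem faceOffset_eq_add (k : Face block) (s : Vec n) :
    faceOffset k s = faceOffset k 0 + faceOffsetLin k s := by
  rcases k with l | r <;> simp [faceOffset, faceOffsetLin, sub_eq_add_neg]

/-- The linear part of the parametrization of a face. -/
def faceDir (k : Face block) : Vec n →L[ℝ] Vec (n + 1) :=
  LinearMap.toContinuousLinearMap
    { toFun := fun s => WithLp.toLp 2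
        ((facePivot k).insertNth (α := fun _ => ℝ) (faceOffsetLin k s) fun a => s a)
      map_add' := fun s t => by
        ext i
        refine Fin.succAboveCases (facePivot k) ?_ (fun a => ?_) i
        · rcases k with l | r
          · simp [faceOffsetLin]
          · simp [faceOffsetLin, Finset.sum_add_distrib, add_comm]
        · simp
      map_smul' := fun c s => by
        ext i
        refine Fin.succAboveCases (facePivot k) ?_ (fun a => ?_) i
        · rcases k with l | r
          · simp [faceOffsetLin]
          · simp [faceOffsetLin, Finset.mul_sum]
        · simp }

theorem faceDir_succAbove (k : Face block) (s : Vec n) (a : Fin n) :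
    faceDir k s ((facePivot k).succAbove a) = s a := by
  simp [faceDir]

theorem faceParam_eq_add (k : Face block) (s : Vec n) :
    faceParam block k s = faceParam block k 0 + faceDir k s := by
  rw [faceParam_eq, faceParam_eq]
  ext i
  refine Fin.succAboveCases (facePivot k) ?_ (fun a => ?_) i
  · simp [faceDir, faceOffset_eq_add k s]
  · simp [faceDir]

theorem hasFDerivAt_faceParam (k : Face block) (s : Vec n) :
    HasFDerivAt (faceParam block k) (faceDir k) s := by
  rw [funext (faceParam_eq_add k)]
  exact (faceDir k).hasFDerivAt.const_add _

theorem continuous_faceParam (k : Face block) : Continuous (faceParam block k) :=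
  continuous_iff_continuousAt.2 fun s => (hasFDerivAt_faceParam k s).continuousAt

/-- The vector along which the barycentric coordinate of a face grows at unit rate. -/
def faceNormalDir (k : Face block) : Vec (n + 1) := EuclideanSpace.single (facePivot k) (faceSign k)

theorem baryDeriv_faceNormalDir (k : Face block) : baryDeriv block k (faceNormalDir k) = 1 := by
  rcases k with l | r
  · simp [baryDeriv, bcoordDeriv, faceNormalDir, faceSign, facePivot]
  · simp [baryDeriv, bcoordDeriv, faceNormalDir, faceSign, facePivot, r.2.choose_spec]

theorem bary_faceParam (k : Face block) (s : Vec n) : bary block k (faceParam block k s) = 0 := by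
  rcases k with l | r
  · simp [bary, faceParam]
  · simp only [bary, faceParam, Finset.sum_filter]
    rw [Fin.sum_univ_succAbove _ r.2.choose, if_pos r.2.choose_spec]
    simp

theorem baryDeriv_faceDir (k : Face block) (s : Vec n) : baryDeriv block k (faceDir k s) = 0 := by
  have h1 := bary_eq_add k (faceParam block k s)
  have h2 := bary_eq_add k (faceParam block k 0)
  rw [bary_faceParam, faceParam_eq_add, map_add] at h1
  rw [bary_faceParam] at h2
  linarith

theorem exists_faceParam_eq (k : Face block) {x : Vec (n + 1)} (hx : bary block k x = 0) :
    ∃ s, faceParam block k s = x := by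
  refine ⟨WithLp.toLp 2 fun a => x ((facePivot k).succAbove a), ?_⟩
  rw [faceParam_eq]
  ext i
  refine Fin.succAboveCases (facePivot k) ?_ (fun a => ?_) i
  · rcases k with l | r
    · simp [faceOffset, facePivot]
      exact hx.symm
    · simp only [faceOffset, facePivot, Fin.insertNth_apply_same]
      simp only [bary, Finset.sum_filter] at hx
      rw [Fin.sum_univ_succAbove _ r.2.choose, if_pos r.2.choose_spec] at hx
      simp only [Finset.sum_filter]
      linarith
  · simp

/-- The coordinates on the reference element that consist of the parameters on a face and of the
barycentric coordinate of the face. -/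
def collar (k : Face block) (q : Vec n × ℝ) : Vec (n + 1) :=
  faceParam block k q.1 + q.2 • faceNormalDir k

theorem continuous_collar (k : Face block) : Continuous (collar k) :=
  ((continuous_faceParam k).comp continuous_fst).add (continuous_snd.smul continuous_const)

theorem bary_collar (k : Face block) (q : Vec n × ℝ) : bary block k (collar k q) = q.2 := by
  have h := bary_eq_add k (faceParam block k q.1)
  rw [bary_faceParam] at h
  rw [collar, bary_eq_add, map_add, map_smul, baryDeriv_faceNormalDir, ← add_assoc, ← h]
  simp

theorem collar_succAbove (k : Face block) (q : Vec n × ℝ) (a : Fin n) :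
    collar k q ((facePivot k).succAbove a) = q.1 a := by
  simp [collar, faceParam_eq, faceNormalDir]

/-- The collar map is a shear, which translates or reflects each fibre, followed by inserting the
pivot coordinate; `faceSign` is `±1`, so volume is not scaled. -/
theorem measurePreserving_collar (k : Face block) :
    MeasurePreserving (collar k) (volume.prod volume) volume := by
  have h1 : MeasurePreserving (fun q : Vec n × ℝ => (q.1, faceOffset k q.1 + q.2 * faceSign k))
      (volume.prod volume) (volume.prod volume) := by
    have hm : Measurable (faceOffset k) := by
      have : Continuous (faceOffset k) := by
        rcases k with l | r
        · exact continuous_const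
        · exact continuous_const.sub (continuous_finsetSum _ fun a _ =>
            (EuclideanSpace.proj (𝕜 := ℝ) _).continuous)
      exact this.measurable
    refine (MeasurePreserving.id volume).skew_product
      (g := fun s t => faceOffset k s + t * faceSign k) ?_ ?_
    · exact (hm.comp measurable_fst).add (measurable_snd.mul_const _)
    · refine Eventually.of_forall fun s => ?_
      rcases k with l | r
      · simpa [faceSign] using (measurePreserving_add_left volume (faceOffset (Sum.inl l) s)).map_eq
      · simpa [faceSign, ← sub_eq_add_neg] using
          (Measure.measurePreserving_sub_left volume (faceOffset (Sum.inr r) s)).map_eq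
  have h2 := ((PiLp.volume_preserving_ofLp (Fin n)).prod (MeasurePreserving.id volume)).comp h1
  have h3 := Measure.measurePreserving_swap.comp h2
  have h4 := ((volume_preserving_piFinSuccAbove (fun _ : Fin (n + 1) => ℝ) (facePivot k)).symm).comp
    h3
  have h5 := (PiLp.volume_preserving_toLp (Fin (n + 1))).comp h4
  have he : collar k = WithLp.toLp 2 ∘
      ⇑(MeasurableEquiv.piFinSuccAbove (fun _ : Fin (n + 1) => ℝ) (facePivot k)).symm ∘ Prod.swap ∘
      Prod.map WithLp.ofLp id ∘ fun q => (q.1, faceOffset k q.1 + q.2 * faceSign k) := by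
    funext q
    ext i
    change _ = (facePivot k).insertNth (α := fun _ => ℝ) (faceOffset k q.1 + q.2 * faceSign k)
      q.1.ofLp i
    refine Fin.succAboveCases (facePivot k) ?_ (fun a => ?_) i
    · simp [collar, faceParam_eq, faceNormalDir]
    · simp [collar, faceParam_eq, faceNormalDir]
  rw [he]
  exact h5

theorem ae_bary_faceParam_ne_zero (k : Face block) :
    ∀ᵐ s : Vec n, ∀ l : Face block, l ≠ k → bary block l (faceParam block k s) ≠ 0 := by
  refine ae_all_iff.2 fun l => ?_
  by_cases hl : l = k
  · simp [hl]
  obtain ⟨x, hx, hx'⟩ := exists_bary_eq_zero_ne_zero hl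
  obtain ⟨s, rfl⟩ := exists_faceParam_eq k hx
  have h := volume_affine_zeroSet volume (f := fun s => bary block l (faceParam block k s))
    (c := bary block l (faceParam block k 0)) (D := (baryDeriv block l).comp (faceDir k))
    (fun s => by
      rw [bary_eq_add, faceParam_eq_add, map_add, bary_eq_add l (faceParam block k 0)]
      simp [add_assoc]) hx'
  rw [ae_iff]
  simpa [hl] using h

end Geometry

/-! ### The one-dimensional transition function -/

open Filter Topology

theorem continuous_deriv_smoothTransition : Continuous (deriv Real.smoothTransition) :=
  (Real.smoothTransition.contDiff (n := 1)).continuous_deriv le_rfl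

theorem deriv_smoothTransition_of_notMem {t : ℝ} (ht : t ∉ Set.Icc (0 : ℝ) 1) :
    deriv Real.smoothTransition t = 0 := by
  rw [Set.mem_Icc, not_and_or, not_le, not_le] at ht
  rcases ht with ht | ht
  · have : Real.smoothTransition =ᶠ[𝓝 t] fun _ => 0 := by
      filter_upwards [Iio_mem_nhds ht] with x hx
      exact Real.smoothTransition.zero_of_nonpos (le_of_lt hx)
    rw [this.deriv_eq, deriv_const]
  · have : Real.smoothTransition =ᶠ[𝓝 t] fun _ => 1 := by
      filter_upwards [Ioi_mem_nhds ht] with x hx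
      exact Real.smoothTransition.one_of_one_le (le_of_lt hx)
    rw [this.deriv_eq, deriv_const]

theorem exists_abs_deriv_smoothTransition_le :
    ∃ M : ℝ, 0 ≤ M ∧ ∀ t, |deriv Real.smoothTransition t| ≤ M := by
  obtain ⟨M, hM⟩ := isCompact_Icc.exists_bound_of_continuousOn (s := Set.Icc (0 : ℝ) 1)
    continuous_deriv_smoothTransition.continuousOn
  have h0 : 0 ≤ M := (norm_nonneg _).trans (hM 0 (by simp))
  refine ⟨M, h0, fun t => ?_⟩
  by_cases ht : t ∈ Set.Icc (0 : ℝ) 1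
  · exact hM t ht
  · rw [deriv_smoothTransition_of_notMem ht]
    simpa using h0

/-- The unit mass that normalizes the limit of the layers. -/
theorem integral_deriv_smoothTransition : ∫ t, deriv Real.smoothTransition t = 1 := by
  have h1 : ∫ t in Set.Icc (0 : ℝ) 1, deriv Real.smoothTransition t =
      ∫ t, deriv Real.smoothTransition t :=
    setIntegral_eq_integral_of_forall_compl_eq_zero fun t ht => deriv_smoothTransition_of_notMem ht
  rw [← h1, integral_Icc_eq_integral_Ioc, ← intervalIntegral.integral_of_le zero_le_one,
    intervalIntegral.integral_deriv_eq_sub]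
  · simp [Real.smoothTransition.zero_of_nonpos, Real.smoothTransition.one_of_one_le]
  · intro x _
    exact (Real.smoothTransition.contDiff (n := 1)).differentiable one_ne_zero x
  · exact continuous_deriv_smoothTransition.intervalIntegrable _ _

/-! ### Concentration of the boundary layers on the faces -/

section Layer

variable {n : ℕ} {block : Fin (n + 1) → Fin (n + 1)}

open Classical in
/-- The rate of change of the smooth cutoff `∏ l, s ((N + 1) b_l)` in the direction of the
barycentric coordinate `b_k`: it concentrates on the face `k` as `N → ∞`. -/
def layer (k : Face block) (N : ℕ) (x : Vec (n + 1)) : ℝ :=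
  (∏ l ∈ Finset.univ.erase k, Real.smoothTransition ((N + 1) * bary block l x)) *
    ((N + 1) * deriv Real.smoothTransition ((N + 1) * bary block k x))

theorem continuous_layer (k : Face block) (N : ℕ) : Continuous (layer k N) :=
  (continuous_finsetProd _ fun l _ => Real.smoothTransition.continuous.comp
    (continuous_const.mul (continuous_bary l))).mul (continuous_const.mul
    (continuous_deriv_smoothTransition.comp (continuous_const.mul (continuous_bary k))))

/-- The integrand of the layer integral in rescaled collar coordinates. -/
def collarIntegrand (k : Face block) (g : Vec (n + 1) → Vec (n + 1)) (N : ℕ) (s : Vec n)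
    (τ : ℝ) : Vec (n + 1) :=
  ((N + 1 : ℝ)⁻¹ * layer k N (collar k (s, (N + 1 : ℝ)⁻¹ * τ))) •
    g (collar k (s, (N + 1 : ℝ)⁻¹ * τ))

/-- A majorant independent of `N`, for dominated convergence in `τ` and then in `s`. The factor `N +
1` of the layer cancels against the rescaling, the derivative of the transition confines `τ` to `[0,
1]`, and membership in the element confines `s` to the unit box. -/
theorem norm_collarIntegrand_le {M C : ℝ} (hM : ∀ t, |deriv Real.smoothTransition t| ≤ M)
    (k : Face block) {g : Vec (n + 1) → Vec (n + 1)} (hC : ∀ x, ‖g x‖ ≤ C)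
    (hg : ∀ x ∉ refElement block, g x = 0) (N : ℕ) (s : Vec n) (τ : ℝ) :
    ‖collarIntegrand k g N s τ‖ ≤ (Set.Icc (0 : ℝ) 1).indicator
      (fun _ => {s : Vec n | ∀ a, s a ∈ Set.Icc (0 : ℝ) 1}.indicator (fun _ => M * C) s) τ := by
  have hN : (0 : ℝ) < N + 1 := by positivity
  have hM0 : 0 ≤ M := (abs_nonneg _).trans (hM 0)
  have hC0 : 0 ≤ C := (norm_nonneg _).trans (hC 0)
  by_cases hx : collar k (s, (N + 1 : ℝ)⁻¹ * τ) ∈ refElement block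
  · by_cases hτ : τ ∈ Set.Icc (0 : ℝ) 1
    · have hs : s ∈ {s : Vec n | ∀ a, s a ∈ Set.Icc (0 : ℝ) 1} := fun a => by
        have := refElement_coord_mem hx ((facePivot k).succAbove a)
        rwa [collar_succAbove] at this
      rw [Set.indicator_of_mem hτ, Set.indicator_of_mem hs, collarIntegrand, norm_smul]
      refine mul_le_mul ?_ (hC _) (norm_nonneg _) hM0
      rw [layer, bary_collar, mul_inv_cancel_left₀ hN.ne', mul_left_comm,
        inv_mul_cancel_left₀ hN.ne', norm_mul]
      refine (mul_le_of_le_one_left (norm_nonneg _) ?_).trans (hM τ)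
      rw [Real.norm_of_nonneg (Finset.prod_nonneg fun _ _ => Real.smoothTransition.nonneg _)]
      exact Finset.prod_le_one (fun _ _ => Real.smoothTransition.nonneg _)
        fun _ _ => Real.smoothTransition.le_one _
    · rw [Set.indicator_of_notMem hτ, collarIntegrand, layer, bary_collar,
        mul_inv_cancel_left₀ hN.ne', deriv_smoothTransition_of_notMem hτ]
      simp
  · rw [collarIntegrand, hg _ hx, smul_zero, norm_zero]
    exact Set.indicator_nonneg (fun _ _ => Set.indicator_nonneg (fun _ _ => mul_nonneg hM0 hC0) _) _

/-- Off the other face hyperplanes a point of the hyperplane `k` is either inside its face, where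
all other cutoff factors eventually equal one, or outside the element, where some barycentric
coordinate stays negative nearby and the integrand is eventually zero. -/
theorem tendsto_collarIntegrand (k : Face block) {G : Vec (n + 1) → Vec (n + 1)}
    (hG : ContinuousOn G (refElement block)) {s : Vec n}
    (hs : ∀ l : Face block, l ≠ k → bary block l (faceParam block k s) ≠ 0) (τ : ℝ) :
    Tendsto (fun N => collarIntegrand k ((refElement block).indicator G) N s τ) atTop
      (𝓝 (deriv Real.smoothTransition τ •
        (refElement block).indicator G (faceParam block k s))) := by
  have hN : ∀ N : ℕ, (N + 1 : ℝ) ≠ 0 := fun N => by positivity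
  by_cases hτ : τ ∈ Set.Icc (0 : ℝ) 1
  swap
  · simp [collarIntegrand, layer, bary_collar, mul_inv_cancel_left₀ (hN _),
      deriv_smoothTransition_of_notMem hτ]
  have hlim : Tendsto (fun N : ℕ => collar k (s, (N + 1 : ℝ)⁻¹ * τ)) atTop
      (𝓝 (faceParam block k s)) := by
    have h1 : Tendsto (fun N : ℕ => (s, (N + 1 : ℝ)⁻¹ * τ)) atTop (𝓝 (s, 0)) := by
      refine tendsto_const_nhds.prodMk_nhds ?_
      simpa using (tendsto_one_div_add_atTop_nhds_zero_nat (𝕜 := ℝ)).mul_const τ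
    have h2 := ((continuous_collar k).tendsto (s, 0)).comp h1
    have h3 : collar k (s, 0) = faceParam block k s := by simp [collar]
    rwa [h3] at h2
  have hblim : ∀ l : Face block, Tendsto (fun N : ℕ =>
      bary block l (collar k (s, (N + 1 : ℝ)⁻¹ * τ))) atTop (𝓝 (bary block l (faceParam block k s))) :=
    fun l => ((continuous_bary l).tendsto _).comp hlim
  by_cases hmem : faceParam block k s ∈ refElement block
  · have hpos : ∀ l : Face block, l ≠ k → 0 < bary block l (faceParam block k s) := fun l hl =>
      lt_of_le_of_ne (hmem l) (hs l hl).symm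
    have hNtop : Tendsto (fun N : ℕ => (N + 1 : ℝ)) atTop atTop :=
      tendsto_atTop_add_const_right _ _ tendsto_natCast_atTop_atTop
    have hev : ∀ᶠ N : ℕ in atTop, ∀ l : Face block, l ≠ k →
        1 ≤ (N + 1 : ℝ) * bary block l (collar k (s, (N + 1 : ℝ)⁻¹ * τ)) := by
      refine eventually_all.2 fun l => ?_
      by_cases hl : l = k
      · simp [hl]
      · filter_upwards [(hNtop.atTop_mul_pos (hpos l hl) (hblim l)).eventually_ge_atTop 1] with N hN' _
        exact hN'
    have hin : ∀ᶠ N : ℕ in atTop, collar k (s, (N + 1 : ℝ)⁻¹ * τ) ∈ refElement block := by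
      filter_upwards [hev] with N hev l
      by_cases hl : l = k
      · subst hl
        rw [bary_collar]
        exact mul_nonneg (by positivity) hτ.1
      · exact le_of_lt (pos_of_mul_pos_right (zero_lt_one.trans_le (hev l hl)) (by positivity))
    have hGlim := (hG _ hmem).tendsto.comp (tendsto_nhdsWithin_iff.2 ⟨hlim, hin⟩)
    rw [Set.indicator_of_mem hmem]
    refine (hGlim.const_smul (deriv Real.smoothTransition τ)).congr' ?_
    filter_upwards [hev, hin] with N hev hin
    rw [collarIntegrand, Set.indicator_of_mem hin, layer, bary_collar,
      mul_inv_cancel_left₀ (hN N), Finset.prod_eq_one, one_mul, inv_mul_cancel_left₀ (hN N)]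
    · rfl
    · intro l hl
      exact Real.smoothTransition.one_of_one_le (hev l (Finset.ne_of_mem_erase hl))
  · obtain ⟨l, hl⟩ : ∃ l : Face block, bary block l (faceParam block k s) < 0 := by
      by_contra! h
      exact hmem h
    rw [Set.indicator_of_notMem hmem, smul_zero]
    refine tendsto_const_nhds.congr' ?_
    filter_upwards [(hblim l).eventually_lt_const hl] with N hlt
    rw [collarIntegrand, Set.indicator_of_notMem (fun h : _ ∈ refElement block => absurd (h l) (not_le.2 hlt)), smul_zero]

/-- In collar coordinates, with the normal variable scaled by `N + 1`, the layer becomes a fixed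
profile of mass one in `τ` while the evaluation point tends to the face. -/
theorem tendsto_integral_layer (k : Face block) {G : Vec (n + 1) → Vec (n + 1)}
    (hG : ContinuousOn G (refElement block)) :
    Tendsto (fun N => ∫ x in refElement block, layer k N x • G x) atTop
      (𝓝 (∫ s in {s | faceParam block k s ∈ refElement block}, G (faceParam block k s))) := by
  classical
  obtain ⟨M, hM0, hM⟩ := exists_abs_deriv_smoothTransition_le
  obtain ⟨C, hC⟩ := isCompact_refElement.exists_bound_of_continuousOn hG
  set g := (refElement block).indicator G with hg
  have hC' : ∀ x, ‖g x‖ ≤ |C| := fun x => by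
    by_cases hx : x ∈ refElement block
    · rw [hg, Set.indicator_of_mem hx]
      exact (hC x hx).trans (le_abs_self C)
    · rw [hg, Set.indicator_of_notMem hx]
      simp
  have hg0 : ∀ x ∉ refElement block, g x = 0 := fun x hx => Set.indicator_of_notMem hx _
  have hgm : Measurable g := by
    rw [hg, ← Set.piecewise_eq_indicator]
    exact ContinuousOn.measurable_piecewise hG continuousOn_const
      isClosed_refElement.measurableSet
  have hbox : MeasurableSet {s : Vec n | ∀ a, s a ∈ Set.Icc (0 : ℝ) 1} :=
    (isCompact_unitBox n).isClosed.measurableSet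
  have hint : ∀ N, Integrable (fun x => layer k N x • g x) := fun N => by
    have h1 : IntegrableOn (fun x => layer k N x • G x) (refElement block) :=
      ((continuous_layer k N).continuousOn.smul hG).integrableOn_compact isCompact_refElement
    rw [← integrable_indicator_iff isClosed_refElement.measurableSet] at h1
    refine h1.congr (Eventually.of_forall fun x => ?_)
    exact Set.indicator_smul_apply _ _ _ _
  have hprod : ∀ N, Integrable (fun q => layer k N (collar k q) • g (collar k q))
      (volume.prod volume) := fun N =>
    ((measurePreserving_collar k).integrable_comp (hint N).aestronglyMeasurable).2 (hint N)
  -- The substitution `t = τ / (N + 1)`; its Jacobian is the factor `(N + 1)⁻¹` in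
  -- `collarIntegrand`.
  have hscale : ∀ N (s : Vec n), ∫ t, layer k N (collar k (s, t)) • g (collar k (s, t)) =
      ∫ τ, collarIntegrand k g N s τ := fun N s => by
    have hN : (0 : ℝ) < N + 1 := by positivity
    have := Measure.integral_comp_inv_mul_left
      (fun t => layer k N (collar k (s, t)) • g (collar k (s, t))) (N + 1 : ℝ)
    simp only [collarIntegrand, mul_smul]
    rw [integral_smul, this, abs_of_pos hN, inv_smul_smul₀ hN.ne']
  have heq : ∀ N, ∫ x in refElement block, layer k N x • G x =
      ∫ s : Vec n, ∫ τ, collarIntegrand k g N s τ := fun N => by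
    rw [← integral_indicator isClosed_refElement.measurableSet]
    simp only [Set.indicator_smul_apply, ← hg]
    simp only [← hscale]
    rw [← integral_prod _ (hprod N), ← (measurePreserving_collar k).map_eq,
      integral_map (measurePreserving_collar k).measurable.aemeasurable]
    rw [(measurePreserving_collar k).map_eq]
    exact (hint N).aestronglyMeasurable
  simp only [heq]
  have hlimeq : ∫ s in {s | faceParam block k s ∈ refElement block}, G (faceParam block k s) =
      ∫ s, g (faceParam block k s) := by
    have hm : MeasurableSet {s | faceParam block k s ∈ refElement block} :=
      (isClosed_refElement.preimage (continuous_faceParam k)).measurableSet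
    rw [← integral_indicator hm]
    rfl
  rw [hlimeq]
  refine tendsto_integral_of_dominated_convergence
    ({s : Vec n | ∀ a, s a ∈ Set.Icc (0 : ℝ) 1}.indicator fun _ => M * |C|) ?_ ?_ ?_ ?_
  · intro N
    simp only [← hscale]
    exact (hprod N).integral_prod_left.aestronglyMeasurable
  · exact (integrable_indicator_iff hbox).2
      (integrableOn_const (isCompact_unitBox n).measure_lt_top.ne enorm_ne_top)
  · intro N
    refine Eventually.of_forall fun s => ?_
    have hb : Integrable ((Set.Icc (0 : ℝ) 1).indicator (fun _ =>
        {s : Vec n | ∀ a, s a ∈ Set.Icc (0 : ℝ) 1}.indicator (fun _ => M * |C|) s)) :=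
      (integrable_indicator_iff measurableSet_Icc).2 (integrableOn_const (by simp) enorm_ne_top)
    refine (norm_integral_le_of_norm_le hb (Eventually.of_forall
      (norm_collarIntegrand_le hM k hC' hg0 N s))).trans (le_of_eq ?_)
    rw [integral_indicator measurableSet_Icc]
    simp
  · filter_upwards [ae_bary_faceParam_ne_zero k] with s hs
    have h1 : g (faceParam block k s) =
        ∫ τ, deriv Real.smoothTransition τ • g (faceParam block k s) := by
      rw [integral_smul_const, integral_deriv_smoothTransition, one_smul]
    rw [h1]
    have hb : Integrable ((Set.Icc (0 : ℝ) 1).indicator (fun _ =>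
        {s : Vec n | ∀ a, s a ∈ Set.Icc (0 : ℝ) 1}.indicator (fun _ => M * |C|) s)) :=
      (integrable_indicator_iff measurableSet_Icc).2 (integrableOn_const (by simp) enorm_ne_top)
    refine tendsto_integral_of_dominated_convergence _ ?_ hb ?_ ?_
    · intro N
      have hmc : Measurable fun τ : ℝ => collar k (s, (N + 1 : ℝ)⁻¹ * τ) :=
        ((continuous_collar k).comp (by fun_prop)).measurable
      exact ((((continuous_layer k N).measurable.comp hmc).const_mul _).smul
        (hgm.comp hmc)).aestronglyMeasurable
    · exact fun N => Eventually.of_forall (norm_collarIntegrand_le hM k hC' hg0 N s)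
    · exact Eventually.of_forall (tendsto_collarIntegrand k hG hs)

end Layer

/-! ### Gram determinants, compactly supported gradients, cutoffs -/

open Filter Topology

/-- The left side is the `(0, 0)` entry of `adj (Aᵀ A) = adj A * adj Aᵀ`, hence the squared length
of row `0` of `adj A`. Applying `adj Aᵀ` to `Aᵀ g = e₀` identifies this row as `det A • g`. -/
theorem det_submatrix_transpose_mul_self {n : ℕ} {A : Matrix (Fin (n + 1)) (Fin (n + 1)) ℝ}
    {g : Fin (n + 1) → ℝ} (hg : Aᵀ *ᵥ g = Pi.single 0 1) :
    ((Aᵀ * A).submatrix Fin.succ Fin.succ).det = A.det ^ 2 * (g ⬝ᵥ g) := by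
  have h1 : ((Aᵀ * A).submatrix Fin.succ Fin.succ).det = (Aᵀ * A).adjugate 0 0 := by
    rw [Matrix.adjugate_fin_succ_eq_det_submatrix]
    simp only [Fin.val_zero, add_zero, pow_zero, one_mul]
    rfl
  have h2 : ∀ i, A.adjugate 0 i = A.det * g i := fun i => by
    have h3 : Aᵀ.adjugate *ᵥ (Aᵀ *ᵥ g) = A.det • g := by
      rw [Matrix.mulVec_mulVec, Matrix.adjugate_mul, Matrix.det_transpose, Matrix.smul_mulVec,
        Matrix.one_mulVec]
    rw [hg] at h3
    have h4 := congrFun h3 i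
    rw [Matrix.mulVec_single_one, ← Matrix.adjugate_transpose] at h4
    exact h4
  rw [h1, Matrix.adjugate_mul_distrib, Matrix.mul_apply, ← Matrix.adjugate_transpose, dotProduct,
    Finset.mul_sum]
  refine Finset.sum_congr rfl fun i _ => ?_
  rw [Matrix.transpose_apply, h2]
  ring

theorem continuousOn_gradient {d : ℕ} {f : Vec d → ℝ} {U : Set (Vec d)} (hU : IsOpen U)
    (hf : ContDiffOn ℝ 1 f U) : ContinuousOn (gradient f) U :=
  (InnerProductSpace.toDual ℝ (Vec d)).symm.continuous.comp_continuousOn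
    (hf.continuousOn_fderiv_of_isOpen hU le_rfl)

/-- Integration by parts against the constant `1`, one direction at a time. -/
theorem integral_gradient_eq_zero {d : ℕ} {f : Vec d → ℝ} (hf : ContDiff ℝ 1 f)
    (hc : HasCompactSupport f) : ∫ x, gradient f x = 0 := by
  have hint : Integrable (gradient f) := by
    have hcont : Continuous (gradient f) :=
      (InnerProductSpace.toDual ℝ (Vec d)).symm.continuous.comp (hf.continuous_fderiv one_ne_zero)
    exact hcont.integrable_of_hasCompactSupport ((hc.fderiv ℝ).comp_left (map_zero _))
  refine ext_inner_left ℝ fun v => ?_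
  rw [← integral_inner hint, inner_zero_right]
  simp only [inner_gradient_right, conj_trivial]
  have hfv : Integrable fun x => fderiv ℝ f x v :=
    ((hf.continuous_fderiv one_ne_zero).clm_apply continuous_const).integrable_of_hasCompactSupport
      ((hc.fderiv ℝ).comp_left (g := fun L : Vec d →L[ℝ] ℝ => L v) rfl)
  have h := integral_mul_fderiv_eq_neg_fderiv_mul_of_integrable (μ := volume)
    (f := f) (g := fun _ : Vec d => (1 : ℝ)) (v := v) (by simpa using hfv) (by simp)
    (by simpa using hf.continuous.integrable_of_hasCompactSupport hc)
    (fun x _ => hf.differentiable one_ne_zero x) (fun x _ => differentiableAt_const _)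
  simp at h
  exact h

section Cutoff

variable {n : ℕ} {block : Fin (n + 1) → Fin (n + 1)}

variable (block) in
/-- A smooth cutoff function supported in the reference element. -/
def cutoff (N : ℕ) (x : Vec (n + 1)) : ℝ :=
  ∏ l : Face block, Real.smoothTransition ((N + 1) * bary block l x)

theorem contDiff_cutoff (N : ℕ) : ContDiff ℝ 1 (cutoff block N) :=
  contDiff_prod fun l _ => (Real.smoothTransition.contDiff (n := 1)).comp
    (contDiff_const.mul (contDiff_bary l))

theorem cutoff_eq_zero (N : ℕ) {x : Vec (n + 1)} (hx : x ∉ refElement block) :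
    cutoff block N x = 0 := by
  obtain ⟨l, hl⟩ : ∃ l : Face block, bary block l x < 0 := by
    by_contra! h
    exact hx h
  exact Finset.prod_eq_zero (Finset.mem_univ l)
    (Real.smoothTransition.zero_of_nonpos (mul_nonpos_of_nonneg_of_nonpos (by positivity) hl.le))

theorem norm_cutoff_le (N : ℕ) (x : Vec (n + 1)) : ‖cutoff block N x‖ ≤ 1 := by
  rw [cutoff, Real.norm_of_nonneg (Finset.prod_nonneg fun _ _ => Real.smoothTransition.nonneg _)]
  exact Finset.prod_le_one (fun _ _ => Real.smoothTransition.nonneg _)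
    fun _ _ => Real.smoothTransition.le_one _

theorem tendsto_cutoff {x : Vec (n + 1)} (hx : x ∈ openRefElement block) :
    Tendsto (fun N => cutoff block N x) atTop (𝓝 1) := by
  have hNtop : Tendsto (fun N : ℕ => (N + 1 : ℝ)) atTop atTop :=
    tendsto_atTop_add_const_right _ _ tendsto_natCast_atTop_atTop
  have hev : ∀ᶠ N : ℕ in atTop, ∀ l : Face block, 1 ≤ (N + 1 : ℝ) * bary block l x :=
    eventually_all.2 fun l => (hNtop.atTop_mul_const (hx l)).eventually_ge_atTop 1
  refine tendsto_const_nhds.congr' ?_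
  filter_upwards [hev] with N hN
  exact (Finset.prod_eq_one fun l _ => Real.smoothTransition.one_of_one_le (hN l)).symm

theorem hasFDerivAt_cutoff (N : ℕ) (x : Vec (n + 1)) :
    HasFDerivAt (cutoff block N) (∑ k : Face block, layer k N x • baryDeriv block k) x := by
  classical
  have h : ∀ k : Face block, HasFDerivAt
      (fun x => Real.smoothTransition ((N + 1) * bary block k x))
      (((N + 1) * deriv Real.smoothTransition ((N + 1) * bary block k x)) • baryDeriv block k) x :=
    fun k => by
      have h1 := ((hasFDerivAt_bary k x).const_mul (N + 1 : ℝ))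
      have h2 : HasDerivAt Real.smoothTransition _ ((N + 1) * bary block k x) :=
        ((Real.smoothTransition.contDiff (n := 1)).differentiable one_ne_zero _).hasDerivAt
      have h3 := h2.comp_hasFDerivAt x h1
      rwa [smul_smul, mul_comm] at h3
  have h4 := HasFDerivAt.finsetProd (u := (Finset.univ : Finset (Face block))) fun k _ => h k
  refine h4.congr_fderiv (Finset.sum_congr rfl fun k _ => ?_)
  rw [smul_smul, layer]

end Cutoff

/-! ### The divergence theorem on a mapped element -/

namespace Element

variable {n : ℕ} (K : Element n)

theorem contDiffAt_map {x : Vec (n + 1)} (hx : x ∈ K.map.source) : ContDiffAt ℝ 1 K.map x :=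
  K.contDiffOn_map.contDiffAt (K.map.open_source.mem_nhds hx)

theorem contDiffAt_symm {y : Vec (n + 1)} (hy : y ∈ K.map.target) :
    ContDiffAt ℝ 1 K.map.symm y :=
  K.contDiffOn_symm.contDiffAt (K.map.open_target.mem_nhds hy)

theorem hasFDerivAt_map {x : Vec (n + 1)} (hx : x ∈ K.map.source) :
    HasFDerivAt K.map (fderiv ℝ K.map x) x :=
  ((K.contDiffAt_map hx).differentiableAt one_ne_zero).hasFDerivAt

theorem hasFDerivAt_symm {y : Vec (n + 1)} (hy : y ∈ K.map.target) :
    HasFDerivAt K.map.symm (fderiv ℝ K.map.symm y) y :=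
  ((K.contDiffAt_symm hy).differentiableAt one_ne_zero).hasFDerivAt

theorem fderiv_symm_comp_fderiv_map {x : Vec (n + 1)} (hx : x ∈ K.map.source) :
    (fderiv ℝ K.map.symm (K.map x)).comp (fderiv ℝ K.map x) = ContinuousLinearMap.id ℝ _ := by
  have h := (K.hasFDerivAt_symm (K.map.map_source hx)).comp x (K.hasFDerivAt_map hx)
  have h2 : K.map.symm ∘ K.map =ᶠ[𝓝 x] id := by
    filter_upwards [K.map.open_source.mem_nhds hx] with y hy
    exact K.map.left_inv hy
  exact (h.congr_of_eventuallyEq h2.symm).unique (hasFDerivAt_id x)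

theorem fderiv_map_comp_fderiv_symm {x : Vec (n + 1)} (hx : x ∈ K.map.source) :
    (fderiv ℝ K.map x).comp (fderiv ℝ K.map.symm (K.map x)) = ContinuousLinearMap.id ℝ _ := by
  have hy := K.map.map_source hx
  have h1 := K.hasFDerivAt_map hx
  nth_rw 2 [← K.map.left_inv hx] at h1
  have h := h1.comp _ (K.hasFDerivAt_symm hy)
  have h2 : K.map ∘ K.map.symm =ᶠ[𝓝 (K.map x)] id := by
    filter_upwards [K.map.open_target.mem_nhds hy] with y hy
    exact K.map.right_inv hy
  exact (h.congr_of_eventuallyEq h2.symm).unique (hasFDerivAt_id _)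

theorem isCompact_carrier : IsCompact K.carrier :=
  isCompact_refElement.image_of_continuousOn (K.map.continuousOn.mono K.subset_source)

theorem carrier_subset_target : K.carrier ⊆ K.map.target := by
  rintro _ ⟨x, hx, rfl⟩
  exact K.map.map_source (K.subset_source hx)

theorem mem_carrier_iff {y : Vec (n + 1)} (hy : y ∈ K.map.target) :
    y ∈ K.carrier ↔ K.map.symm y ∈ refElement K.block := by
  constructor
  · rintro ⟨x, hx, rfl⟩
    rwa [K.map.left_inv (K.subset_source hx)]
  · exact fun h => ⟨_, h, K.map.right_inv hy⟩

theorem integral_carrier {V : Type*} [NormedAddCommGroup V] [NormedSpace ℝ V]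
    (f : Vec (n + 1) → V) :
    ∫ y in K.carrier, f y =
      ∫ x in refElement K.block, |(fderiv ℝ K.map x).det| • f (K.map x) :=
  integral_image_eq_integral_abs_det_fderiv_smul volume isClosed_refElement.measurableSet
    (fun _ hx => (K.hasFDerivAt_map (K.subset_source hx)).hasFDerivWithinAt)
    (K.map.injOn.mono K.subset_source) f

/-- The gradient of the pulled back barycentric coordinate of a face, at the image of a point. -/
def faceGrad (k : Face K.block) (x : Vec (n + 1)) : Vec (n + 1) :=
  gradient (fun y => bary K.block k (K.map.symm y)) (K.map x)

theorem inner_faceGrad (k : Face K.block) {x : Vec (n + 1)} (hx : x ∈ K.map.source)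
    (v : Vec (n + 1)) :
    inner ℝ (K.faceGrad k x) v = baryDeriv K.block k (fderiv ℝ K.map.symm (K.map x) v) := by
  have h : HasFDerivAt (fun y => bary K.block k (K.map.symm y)) _ (K.map x) :=
    (hasFDerivAt_bary k _).comp (K.map x) (K.hasFDerivAt_symm (K.map.map_source hx))
  rw [faceGrad, inner_gradient_left, h.fderiv]
  rfl

theorem inner_faceGrad_fderiv (k : Face K.block) {x : Vec (n + 1)} (hx : x ∈ K.map.source)
    (v : Vec (n + 1)) :
    inner ℝ (K.faceGrad k x) (fderiv ℝ K.map x v) = baryDeriv K.block k v := by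
  rw [inner_faceGrad K k hx]
  exact congrArg _ (congrArg (fun L : Vec (n + 1) →L[ℝ] Vec (n + 1) => L v)
    (K.fderiv_symm_comp_fderiv_map hx))

variable {block : Fin (n + 1) → Fin (n + 1)}

/-- The matrix of the derivative of the collar coordinates, the normal direction first. -/
def collarMatrix (k : Face block) : Matrix (Fin (n + 1)) (Fin (n + 1)) ℝ :=
  Matrix.of fun i j => (Fin.cases (motive := fun _ => Vec (n + 1)) (faceNormalDir k)
    (fun a => faceDir k (EuclideanSpace.single a 1)) j : Vec (n + 1)) i

/-- The normal column has the single nonzero entry `±1`, at the pivot, and deleting its row and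
column leaves the identity. -/
theorem det_collarMatrix_sq (k : Face block) : (collarMatrix k).det ^ 2 = 1 := by
  have h1 : (collarMatrix k).submatrix (facePivot k).succAbove Fin.succ = 1 := by
    ext i j
    simp [collarMatrix, faceDir_succAbove, Matrix.one_apply]
  rw [Matrix.det_succ_column_zero, Finset.sum_eq_single (facePivot k)]
  · rw [h1, Matrix.det_one, mul_one, mul_pow, ← pow_mul, mul_comm _ 2, pow_mul]
    rcases k with l | r <;> simp [collarMatrix, faceNormalDir, faceSign]
  · intro i _ hi
    simp [collarMatrix, faceNormalDir, hi]
  · simp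

/-- Nanson's formula. Let `A` be the Jacobian times the collar frame: its columns after the first
are the tangents of the parametrization, and the pulled back gradient is dual to the first column,
so `det_submatrix_transpose_mul_self` evaluates the Gram determinant. -/
theorem areaElement_eq (k : Face K.block) {s : Vec n}
    (hs : faceParam K.block k s ∈ K.map.source) :
    K.areaElement k s = |(fderiv ℝ K.map (faceParam K.block k s)).det| *
      ‖K.faceGrad k (faceParam K.block k s)‖ := by
  set x := faceParam K.block k s with hx
  set J := fderiv ℝ K.map x with hJ
  let b := (EuclideanSpace.basisFun (Fin (n + 1)) ℝ).toBasis
  let A : Matrix (Fin (n + 1)) (Fin (n + 1)) ℝ := LinearMap.toMatrix b b J.toLinearMap * collarMatrix k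
  have hA : ∀ i j, A i j = J (Fin.cases (motive := fun _ => Vec (n + 1)) (faceNormalDir k)
    (fun a => faceDir k (EuclideanSpace.single a 1)) j) i := fun i j => by
    have h := congrFun (LinearMap.toMatrix_mulVec_repr b b J.toLinearMap
      (Fin.cases (motive := fun _ => Vec (n + 1)) (faceNormalDir k)
        (fun a => faceDir k (EuclideanSpace.single a 1)) j)) i
    exact h
  have hdet : A.det ^ 2 = J.det ^ 2 := by
    rw [Matrix.det_mul, mul_pow, det_collarMatrix_sq, mul_one, LinearMap.det_toMatrix]
  have hg : Aᵀ *ᵥ (K.faceGrad k x).ofLp = Pi.single 0 1 := by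
    funext j
    have h : (Aᵀ *ᵥ (K.faceGrad k x).ofLp) j = inner ℝ (K.faceGrad k x)
        (J (Fin.cases (motive := fun _ => Vec (n + 1)) (faceNormalDir k)
          (fun a => faceDir k (EuclideanSpace.single a 1)) j)) := by
      simp [Matrix.mulVec, dotProduct, PiLp.inner_apply, hA]
    rw [h, inner_faceGrad_fderiv K k hs]
    refine Fin.cases ?_ (fun a => ?_) j
    · simp [baryDeriv_faceNormalDir]
    · simp [baryDeriv_faceDir]
  have hparam : fderiv ℝ (K.param k) s = J.comp (faceDir k) :=
    ((K.hasFDerivAt_map hs).comp s (hasFDerivAt_faceParam k s)).fderiv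
  have hgram : (Matrix.of fun a b : Fin n =>
      inner ℝ (fderiv ℝ (K.param k) s (EuclideanSpace.single a 1))
        (fderiv ℝ (K.param k) s (EuclideanSpace.single b 1))) =
      (Aᵀ * A).submatrix Fin.succ Fin.succ := by
    ext a b
    simp [hparam, Matrix.mul_apply, PiLp.inner_apply, hA, mul_comm]
  have hdot : (K.faceGrad k x).ofLp ⬝ᵥ (K.faceGrad k x).ofLp = ‖K.faceGrad k x‖ ^ 2 := by
    rw [← real_inner_self_eq_norm_sq, PiLp.inner_apply]
    simp [dotProduct, sq]
  rw [areaElement, hgram, det_submatrix_transpose_mul_self hg, hdet, hdot, ← mul_pow,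
    Real.sqrt_sq_eq_abs, abs_mul, abs_norm]

/-- The density on the reference element of the surface integral of `φ n`, up to the sign. -/
def faceDensity (φ : Vec (n + 1) → ℝ) (k : Face K.block) (x : Vec (n + 1)) : Vec (n + 1) :=
  (|(fderiv ℝ K.map x).det| * φ (K.map x)) • K.faceGrad k x

/-- The norm in the area element cancels the normalization of the normal. What is left,
`faceDensity`, is defined off the face as well, so that layers can be integrated against it. -/
theorem areaElement_smul_normal (φ : Vec (n + 1) → ℝ) (k : Face K.block) {s : Vec n}
    (hs : faceParam K.block k s ∈ K.map.source) :
    K.areaElement k s • (φ (K.param k s) • K.normal k (K.param k s)) =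
      -K.faceDensity φ k (faceParam K.block k s) := by
  rw [areaElement_eq K k hs]
  change _ • (_ • -(‖K.faceGrad k (faceParam K.block k s)‖⁻¹ •
    K.faceGrad k (faceParam K.block k s))) = _
  rw [faceDensity, smul_neg, smul_neg, smul_smul, smul_smul, neg_inj]
  by_cases h : K.faceGrad k (faceParam K.block k s) = 0
  · simp [h]
  · have := norm_ne_zero_iff.2 h
    congr 1
    rw [param]
    field_simp

theorem continuousOn_abs_det : ContinuousOn (fun x => |(fderiv ℝ K.map x).det|) K.map.source :=
  (ContinuousLinearMap.continuous_det.comp_continuousOn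
    (K.contDiffOn_map.continuousOn_fderiv_of_isOpen K.map.open_source le_rfl)).abs

theorem continuousOn_faceDensity {φ : Vec (n + 1) → ℝ} (hφ : ContinuousOn φ K.map.target)
    (k : Face K.block) : ContinuousOn (K.faceDensity φ k) K.map.source := by
  have hmaps : Set.MapsTo K.map K.map.source K.map.target := K.map.mapsTo
  refine (K.continuousOn_abs_det.mul (hφ.comp K.map.continuousOn hmaps)).smul ?_
  exact (continuousOn_gradient K.map.open_target
    ((contDiff_bary k).comp_contDiffOn K.contDiffOn_symm)).comp K.map.continuousOn hmaps

theorem isCompact_faceDomain (k : Face block) :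
    IsCompact {s : Vec n | faceParam block k s ∈ refElement block} := by
  refine (isCompact_unitBox n).of_isClosed_subset
    (isClosed_refElement.preimage (continuous_faceParam k)) fun s hs a => ?_
  have := refElement_coord_mem (Set.mem_ofPred_eq ▸ hs :
    faceParam block k s ∈ refElement block) ((facePivot k).succAbove a)
  simpa [faceParam_eq] using this

theorem integrableOn_areaElement_smul_normal {φ : Vec (n + 1) → ℝ}
    (hφ : ContinuousOn φ K.map.target) (k : Face K.block) :
    IntegrableOn (fun s => K.areaElement k s • (φ (K.param k s) • K.normal k (K.param k s)))
      {s : Vec n | faceParam K.block k s ∈ refElement K.block} := by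
  have hc : ContinuousOn (fun s => -K.faceDensity φ k (faceParam K.block k s))
      {s : Vec n | faceParam K.block k s ∈ refElement K.block} :=
    ((K.continuousOn_faceDensity hφ k).comp (continuous_faceParam k).continuousOn
      fun _ hs => K.subset_source hs).neg
  refine (hc.integrableOn_compact (isCompact_faceDomain k)).congr_fun (fun s hs => ?_)
    (isCompact_faceDomain k).isClosed.measurableSet
  exact (K.areaElement_smul_normal φ k (K.subset_source hs)).symm

theorem faceIntegral_smul_normal (φ : Vec (n + 1) → ℝ) (k : Face K.block) :
    K.faceIntegral k (fun x => φ x • K.normal k x) =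
      -∫ s in {s : Vec n | faceParam K.block k s ∈ refElement K.block},
        K.faceDensity φ k (faceParam K.block k s) := by
  rw [← integral_neg, faceIntegral]
  exact setIntegral_congr_fun (isCompact_faceDomain k).isClosed.measurableSet fun s hs =>
    K.areaElement_smul_normal φ k (K.subset_source hs)

theorem gradient_cutoff_mul {φ : Vec (n + 1) → ℝ} (hφ : ContDiffOn ℝ 1 φ K.map.target) (N : ℕ)
    {x : Vec (n + 1)} (hx : x ∈ K.map.source) :
    gradient (fun y => cutoff K.block N (K.map.symm y) * φ y) (K.map x) =
      cutoff K.block N x • gradient φ (K.map x) +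
        ∑ k, (layer k N x * φ (K.map x)) • K.faceGrad k x := by
  have hy := K.map.map_source hx
  refine ext_inner_right ℝ fun v => ?_
  have h1 : HasFDerivAt (fun y => cutoff K.block N (K.map.symm y)) _ (K.map x) :=
    (hasFDerivAt_cutoff N _).comp (K.map x) (K.hasFDerivAt_symm hy)
  have h2 : HasFDerivAt φ (fderiv ℝ φ (K.map x)) (K.map x) :=
    ((hφ.contDiffAt (K.map.open_target.mem_nhds hy)).differentiableAt one_ne_zero).hasFDerivAt
  have h3 : HasFDerivAt (fun y => cutoff K.block N (K.map.symm y) * φ y) _ _ := h1.mul h2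
  rw [inner_gradient_left, h3.fderiv, inner_add_left, sum_inner]
  simp only [real_inner_smul_left, inner_gradient_left, inner_faceGrad K _ hx,
    K.map.left_inv hx, _root_.add_apply, _root_.smul_apply, ContinuousLinearMap.comp_apply,
    _root_.sum_apply, smul_eq_mul]
  rw [Finset.mul_sum]
  congr 1
  exact Finset.sum_congr rfl fun k _ => by ring

/-- The function `χ_N φ`, extended by zero, is `C¹` with compact support, so its gradient integrates
to zero. The product rule and the change of variables split this integral into the cutoff part and
the layers. -/
theorem integral_cutoff_add_sum_eq_zero {φ : Vec (n + 1) → ℝ}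
    (hφ : ContDiffOn ℝ 1 φ K.map.target) (N : ℕ) :
    (∫ x in refElement K.block,
      cutoff K.block N x • (|(fderiv ℝ K.map x).det| • gradient φ (K.map x))) +
      ∑ k, ∫ x in refElement K.block, layer k N x • K.faceDensity φ k x = 0 := by
  set f : Vec (n + 1) → ℝ :=
    K.carrier.indicator fun y => cutoff K.block N (K.map.symm y) * φ y with hf
  -- On the open target the indicator is redundant, since the cutoff already vanishes off the
  -- reference element; off the target, `f` is locally zero because the carrier is closed.
  have hf1 : ∀ y ∈ K.map.target, f =ᶠ[𝓝 y] fun y => cutoff K.block N (K.map.symm y) * φ y :=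
    fun y hy => by
      filter_upwards [K.map.open_target.mem_nhds hy] with z hz
      by_cases h : z ∈ K.carrier
      · rw [hf, Set.indicator_of_mem h]
      · rw [hf, Set.indicator_of_notMem h, cutoff_eq_zero N (fun h' => h ((K.mem_carrier_iff hz).2 h')),
          zero_mul]
  have hf0 : ∀ y ∉ K.carrier, f =ᶠ[𝓝 y] fun _ => 0 := fun y hy => by
    filter_upwards [K.isCompact_carrier.isClosed.isOpen_compl.mem_nhds hy] with z hz
    exact Set.indicator_of_notMem hz _
  have hfc : ContDiff ℝ 1 f := contDiff_iff_contDiffAt.2 fun y => by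
    by_cases hy : y ∈ K.map.target
    · refine ContDiffAt.congr_of_eventuallyEq ?_ (hf1 y hy)
      exact ((contDiff_cutoff N).contDiffAt.comp y (K.contDiffAt_symm hy)).mul
        (hφ.contDiffAt (K.map.open_target.mem_nhds hy))
    · exact contDiffAt_const.congr_of_eventuallyEq
        (hf0 y fun h => hy (K.carrier_subset_target h))
  have hfs : HasCompactSupport f :=
    HasCompactSupport.intro K.isCompact_carrier fun y hy => Set.indicator_of_notMem hy _
  have h0 := integral_gradient_eq_zero hfc hfs
  rw [← setIntegral_eq_integral_of_forall_compl_eq_zero (s := K.carrier) fun y hy => by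
    rw [(hf0 y hy).gradient_eq]; simp [gradient], integral_carrier] at h0
  rw [← h0, ← integral_finsetSum, ← integral_add]
  · refine setIntegral_congr_fun isClosed_refElement.measurableSet fun x hx => ?_
    have hx := K.subset_source hx
    rw [(hf1 _ (K.map.map_source hx)).gradient_eq, K.gradient_cutoff_mul hφ N hx, smul_add,
      Finset.smul_sum, smul_comm]
    congr 1
    refine Finset.sum_congr rfl fun k _ => ?_
    rw [faceDensity, smul_smul, smul_smul]
    congr 1
    ring
  · refine ContinuousOn.integrableOn_compact isCompact_refElement ?_
    refine (contDiff_cutoff N).continuous.continuousOn.smul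
      ((K.continuousOn_abs_det.mono K.subset_source).smul ?_)
    exact ((continuousOn_gradient K.map.open_target hφ).comp K.map.continuousOn
      K.map.mapsTo).mono K.subset_source
  · refine integrable_finsetSum _ fun k _ =>
      ContinuousOn.integrableOn_compact isCompact_refElement ?_
    exact (continuous_layer k N).continuousOn.smul
      ((K.continuousOn_faceDensity hφ.continuousOn k).mono K.subset_source)
  · intro k _
    refine ContinuousOn.integrableOn_compact isCompact_refElement ?_
    exact (continuous_layer k N).continuousOn.smul
      ((K.continuousOn_faceDensity hφ.continuousOn k).mono K.subset_source)

/-- The divergence theorem on an element. -/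
theorem integral_gradient_eq_sum_faceIntegral {φ : Vec (n + 1) → ℝ}
    (hφ : ContDiffOn ℝ 1 φ K.map.target) :
    ∫ y in K.carrier, gradient φ y = ∑ k, K.faceIntegral k fun x => φ x • K.normal k x := by
  have hgc : ContinuousOn (fun x => |(fderiv ℝ K.map x).det| • gradient φ (K.map x))
      (refElement K.block) :=
    (K.continuousOn_abs_det.mono K.subset_source).smul
      (((continuousOn_gradient K.map.open_target hφ).comp K.map.continuousOn
        K.map.mapsTo).mono K.subset_source)
  have hgi := hgc.integrableOn_compact (μ := volume) isCompact_refElement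
  have h1 : Tendsto (fun N => ∫ x in refElement K.block,
      cutoff K.block N x • (|(fderiv ℝ K.map x).det| • gradient φ (K.map x))) atTop
      (𝓝 (∫ y in K.carrier, gradient φ y)) := by
    rw [integral_carrier]
    refine tendsto_integral_of_dominated_convergence
      (fun x => ‖|(fderiv ℝ K.map x).det| • gradient φ (K.map x)‖) ?_ hgi.norm ?_ ?_
    · exact fun N => ((contDiff_cutoff N).continuous.continuousOn.smul hgc).aestronglyMeasurable
        isClosed_refElement.measurableSet
    · refine fun N => Eventually.of_forall fun x => ?_
      rw [norm_smul (cutoff K.block N x)]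
      exact mul_le_of_le_one_left (norm_nonneg _) (norm_cutoff_le N x)
    · filter_upwards [ae_restrict_of_ae ae_mem_openRefElement,
        ae_restrict_mem isClosed_refElement.measurableSet] with x hx hx'
      simpa using (tendsto_cutoff (hx hx')).smul_const
        (|(fderiv ℝ K.map x).det| • gradient φ (K.map x))
  have h2 := tendsto_finsetSum Finset.univ fun k _ => tendsto_integral_layer k
    ((K.continuousOn_faceDensity hφ.continuousOn k).mono K.subset_source)
  have h3 := h1.add h2
  -- The sequence is identically zero, hence so is its limit: the volume integral plus the face
  -- integrals of the densities.
  simp only [K.integral_cutoff_add_sum_eq_zero hφ] at h3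
  have h4 := tendsto_nhds_unique tendsto_const_nhds h3
  simp only [faceIntegral_smul_normal]
  rw [Finset.sum_neg_distrib]
  exact eq_neg_of_add_eq_zero_left h4.symm

end Element

/-! ### Mass matrix and preconditioned gradients -/

namespace Element

open Filter Topology

variable {n : ℕ} (K : Element n) {p : ℕ}

theorem contDiffOn_basis (i : Node K.block p) : ContDiffOn ℝ 1 (K.basis i) K.map.target :=
  (contDiff_refBasis i).comp_contDiffOn K.contDiffOn_symm

theorem continuousOn_basis (i : Node K.block p) : ContinuousOn (K.basis i) K.carrier :=
  (K.contDiffOn_basis i).continuousOn.mono K.carrier_subset_target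

theorem continuousOn_gradient_basis (i : Node K.block p) :
    ContinuousOn (gradient (K.basis i)) K.carrier :=
  (continuousOn_gradient K.map.open_target (K.contDiffOn_basis i)).mono K.carrier_subset_target

theorem sum_basis (x : Vec (n + 1)) : ∑ i : Node K.block p, K.basis i x = 1 := sum_refBasis _

theorem hasFDerivAt_basis (i : Node K.block p) {x : Vec (n + 1)} (hx : x ∈ K.map.target) :
    HasFDerivAt (K.basis i) (fderiv ℝ (K.basis i) x) x :=
  (((K.contDiffOn_basis i).contDiffAt (K.map.open_target.mem_nhds hx)).differentiableAt
    one_ne_zero).hasFDerivAt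

theorem sum_gradient_basis {x : Vec (n + 1)} (hx : x ∈ K.map.target) :
    ∑ i : Node K.block p, gradient (K.basis i) x = 0 := by
  refine ext_inner_right ℝ fun v => ?_
  have h : HasFDerivAt (fun x => ∑ i : Node K.block p, K.basis i x) _ x :=
    HasFDerivAt.fun_sum fun i _ => K.hasFDerivAt_basis i hx
  simp only [sum_basis] at h
  have h2 := h.unique (hasFDerivAt_const (1 : ℝ) x)
  rw [sum_inner, inner_zero_left]
  simp only [inner_gradient_left]
  rw [← _root_.sum_apply, h2]
  rfl

theorem massMatrix_comm (i j : Node K.block p) : K.massMatrix p i j = K.massMatrix p j i := by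
  simp only [massMatrix, Matrix.of_apply, mul_comm]

theorem integral_basis_mul_sum (i : Node K.block p) (D : Node K.block p → ℝ) :
    ∫ x in K.carrier, K.basis i x * ∑ j, D j * K.basis j x = (K.massMatrix p *ᵥ D) i := by
  simp only [Finset.mul_sum, Matrix.mulVec, dotProduct, massMatrix, Matrix.of_apply]
  rw [integral_finsetSum]
  · refine Finset.sum_congr rfl fun j _ => ?_
    rw [← integral_mul_const]
    refine integral_congr_ae (Eventually.of_forall fun x => ?_)
    simp only
    ring
  · intro j _
    exact ((K.continuousOn_basis i).mul (continuousOn_const.mul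
      (K.continuousOn_basis j))).integrableOn_compact K.isCompact_carrier

/-- With `w = ∑ v_j φ_j`, the quadratic form `vᵀ M_C v` is `∫ w²`. So `w` vanishes almost
everywhere, by continuity everywhere on the open image of the interior, and linear independence
applies. -/
theorem eq_zero_of_massMatrix_mulVec_eq_zero {v : Node K.block p → ℝ}
    (hv : K.massMatrix p *ᵥ v = 0) : v = 0 := by
  set w : Vec (n + 1) → ℝ := fun x => ∑ j, v j * K.basis j x with hw
  have hwc : ContinuousOn w K.carrier :=
    continuousOn_finsetSum _ fun j _ => continuousOn_const.mul (K.continuousOn_basis j)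
  have hint : ∫ x in K.carrier, w x * w x = 0 := by
    have h1 : ∀ x, w x * w x = ∑ i, v i * (K.basis i x * w x) := fun x => by
      conv_lhs => rw [hw]
      simp only
      rw [Finset.sum_mul]
      exact Finset.sum_congr rfl fun i _ => by rw [mul_assoc]
    simp only [h1]
    rw [integral_finsetSum]
    · refine Finset.sum_eq_zero fun i _ => ?_
      rw [integral_const_mul, hw, integral_basis_mul_sum, hv]
      simp
    · intro i _
      exact (continuousOn_const.mul ((K.continuousOn_basis i).mul hwc)).integrableOn_compact
        K.isCompact_carrier
  rw [setIntegral_eq_zero_iff_of_nonneg_ae (Eventually.of_forall fun x => mul_self_nonneg _)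
    ((hwc.mul hwc).integrableOn_compact K.isCompact_carrier)] at hint
  have hsub : K.map '' openRefElement K.block ⊆ K.carrier :=
    Set.image_mono openRefElement_subset
  have hopen : IsOpen (K.map '' openRefElement K.block) :=
    K.map.isOpen_image_of_subset_source isOpen_openRefElement
      (openRefElement_subset.trans K.subset_source)
  have hae : w =ᵐ[volume.restrict (K.map '' openRefElement K.block)] fun _ => 0 := by
    filter_upwards [ae_restrict_of_ae_restrict_of_subset hsub hint] with x hx
    exact mul_self_eq_zero.1 hx
  have heq := Measure.eqOn_open_of_ae_eq hae hopen (hwc.mono hsub) continuousOn_const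
  refine refBasis_coeff_eq_zero fun x hx => ?_
  have hx' : x ∈ openRefElement K.block := fun k => by
    rw [bary_eq_bcoord]
    exact hx _
  have := heq ⟨x, hx', rfl⟩
  simpa [hw, basis, K.map.left_inv (K.subset_source (openRefElement_subset hx'))] using this

theorem isUnit_det_massMatrix : IsUnit (K.massMatrix p).det := by
  rw [← Matrix.isUnit_iff_isUnit_det, ← Matrix.mulVec_injective_iff_isUnit]
  intro v w hvw
  refine sub_eq_zero.1 (K.eq_zero_of_massMatrix_mulVec_eq_zero ?_)
  rw [Matrix.mulVec_sub, sub_eq_zero]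
  exact hvw

theorem integrableOn_basis_smul_gradient (i j : Node K.block p) :
    IntegrableOn (fun x => K.basis i x • gradient (K.basis j) x) K.carrier :=
  ((K.continuousOn_basis i).smul (K.continuousOn_gradient_basis j)).integrableOn_compact
    K.isCompact_carrier

theorem sum_integral_basis_smul_gradient_right (i : Node K.block p) :
    ∑ j : Node K.block p, ∫ x in K.carrier, K.basis i x • gradient (K.basis j) x = 0 := by
  rw [← integral_finsetSum _ fun j _ => K.integrableOn_basis_smul_gradient i j]
  refine setIntegral_eq_zero_of_forall_eq_zero fun x hx => ?_
  rw [← Finset.smul_sum, K.sum_gradient_basis (K.carrier_subset_target hx), smul_zero]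

theorem sum_integral_basis_smul_gradient_left (j : Node K.block p) :
    ∑ i : Node K.block p, ∫ x in K.carrier, K.basis i x • gradient (K.basis j) x =
      ∫ x in K.carrier, gradient (K.basis j) x := by
  rw [← integral_finsetSum _ fun i _ => K.integrableOn_basis_smul_gradient i j]
  simp only [← Finset.sum_smul, sum_basis, one_smul]

theorem sum_precGrad_right (i : Node K.block p) : ∑ j, K.precGrad i j = 0 := by
  ext k
  have h : ∀ i, ∑ j, K.gradMatrix p k i j = 0 := fun i => by
    have := congrArg (EuclideanSpace.proj (𝕜 := ℝ) k) (K.sum_integral_basis_smul_gradient_right i)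
    rw [map_sum, map_zero] at this
    exact this
  simp only [precGrad, WithLp.ofLp_sum, Finset.sum_apply, precGradMatrix,
    Matrix.mul_apply (N := K.gradMatrix p k)]
  rw [Finset.sum_comm]
  simp [← Finset.mul_sum, h]

/-- By symmetry of `M_C`, `1ᵀ M_L = 1ᵀ M_C`, hence `1ᵀ M_L M_C⁻¹ C_k = 1ᵀ C_k`: the preconditioning
keeps the column sums, which the partition of unity evaluates. -/
theorem sum_precGrad_left (j : Node K.block p) :
    ∑ i, K.precGrad i j = ∫ x in K.carrier, gradient (K.basis j) x := by
  ext k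
  have h : ∑ i, K.gradMatrix p k i j = (∫ x in K.carrier, gradient (K.basis j) x) k := by
    have := congrArg (EuclideanSpace.proj (𝕜 := ℝ) k) (K.sum_integral_basis_smul_gradient_left j)
    rw [map_sum] at this
    exact this
  rw [← h]
  have h1 : K.lumpedMass p = (fun _ => (1 : ℝ)) ᵥ* K.massMatrix p := by
    funext i
    simp [lumpedMass, Matrix.vecMul, dotProduct, K.massMatrix_comm i]
  have h2 : (fun _ => (1 : ℝ)) ᵥ* K.precGradMatrix p k =
      (fun _ => (1 : ℝ)) ᵥ* K.gradMatrix p k := by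
    have h3 : (fun _ => (1 : ℝ)) ᵥ* Matrix.diagonal (K.lumpedMass p) = K.lumpedMass p := by
      funext i
      simp [Matrix.vecMul_diagonal]
    rw [precGradMatrix, ← Matrix.vecMul_vecMul, ← Matrix.vecMul_vecMul, h3, h1,
      Matrix.vecMul_vecMul, Matrix.vecMul_vecMul, ← Matrix.mul_assoc, Matrix.mul_nonsing_inv _ K.isUnit_det_massMatrix, Matrix.one_mul]
  have h4 := congrFun h2 j
  simp only [Matrix.vecMul, dotProduct, one_mul] at h4
  simpa [precGrad, WithLp.ofLp_sum] using h4

theorem zero_mem_refElement {block : Fin (n + 1) → Fin (n + 1)} :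
    (0 : Vec (n + 1)) ∈ refElement block := by
  rintro (l | r) <;> simp [bary]

theorem fderiv_symm_eq_of_constantJacobian (hK : K.ConstantJacobian) {x : Vec (n + 1)}
    (hx : x ∈ refElement K.block) :
    fderiv ℝ K.map.symm (K.map x) = fderiv ℝ K.map.symm (K.map 0) := by
  have h0 := K.fderiv_map_comp_fderiv_symm (K.subset_source zero_mem_refElement)
  have h1 := K.fderiv_symm_comp_fderiv_map (K.subset_source hx)
  rw [hK 0 zero_mem_refElement x hx] at h0
  calc fderiv ℝ K.map.symm (K.map x)
      = (fderiv ℝ K.map.symm (K.map x)).comp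
        ((fderiv ℝ K.map x).comp (fderiv ℝ K.map.symm (K.map 0))) := by
        rw [h0, ContinuousLinearMap.comp_id]
    _ = fderiv ℝ K.map.symm (K.map 0) := by
        rw [← ContinuousLinearMap.comp_assoc, h1, ContinuousLinearMap.id_comp]

/-- A constant Jacobian turns `∂_k φ_j` into a directional derivative on the reference element in a
fixed direction `v`, so `∂_k φ_j = ∑ D_l φ_l` with `D` supported on neighbours of `j`. Then column
`j` of `C_k` is `M_C D`, the inverse recovers `D`, and the diagonal `M_L` keeps its zeros. -/
theorem precGrad_eq_zero (hK : K.ConstantJacobian) {i j : Node K.block p}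
    (hij : j ∉ nearestNeighbors i) : K.precGrad i j = 0 := by
  ext k
  set v := fderiv ℝ K.map.symm (K.map 0) (EuclideanSpace.single k 1) with hv
  obtain ⟨D, hD, hsum⟩ := (Finsupp.mem_span_image_iff_linearCombination ℝ).1
    (fderiv_refBasis_mem_span j v)
  rw [Finsupp.linearCombination_apply,
    Finsupp.sum_fintype D (fun i a => a • (refBasis i : Vec (n + 1) → ℝ))
      fun i => zero_smul ℝ _] at hsum
  have hDi : D i = 0 := by
    by_contra h
    exact hij ((Finsupp.mem_supported ℝ D).1 hD (Finsupp.mem_support_iff.2 h))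
  have hgrad : ∀ x ∈ K.carrier, gradient (K.basis j) x k = ∑ l, D l * K.basis l x := by
    rintro _ ⟨x, hx, rfl⟩
    have hxs := K.subset_source hx
    have h1 : gradient (K.basis j) (K.map x) k =
        fderiv ℝ (K.basis j) (K.map x) (EuclideanSpace.single k 1) := by
      rw [← inner_gradient_left, EuclideanSpace.inner_single_right]
      simp
    have h2 : HasFDerivAt (K.basis j) _ (K.map x) :=
      ((contDiff_refBasis j).differentiable one_ne_zero _).hasFDerivAt.comp (K.map x)
        (K.hasFDerivAt_symm (K.map.map_source hxs))
    rw [h1, h2.fderiv, ContinuousLinearMap.comp_apply, K.map.left_inv hxs,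
      K.fderiv_symm_eq_of_constantJacobian hK hx, ← hv]
    have h3 := congrFun hsum x
    rw [Finset.sum_apply] at h3
    simp only [Pi.smul_apply, smul_eq_mul] at h3
    rw [← h3]
    simp [basis, K.map.left_inv hxs]
  have hC : ∀ a, K.gradMatrix p k a j = (K.massMatrix p *ᵥ D) a := fun a => by
    rw [← integral_basis_mul_sum]
    have h1 := (EuclideanSpace.proj (𝕜 := ℝ) k).integral_comp_comm
      (K.integrableOn_basis_smul_gradient a j)
    refine h1.symm.trans (setIntegral_congr_fun K.isCompact_carrier.isClosed.measurableSet
      fun x hx => ?_)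
    simp [hgrad x hx]
  have hinv : ((K.massMatrix p)⁻¹ * K.gradMatrix p k) i j = D i := by
    have h1 : (fun a => K.gradMatrix p k a j) = K.massMatrix p *ᵥ D := funext hC
    change ((K.massMatrix p)⁻¹ *ᵥ fun a => K.gradMatrix p k a j) i = _
    rw [h1, Matrix.mulVec_mulVec, Matrix.nonsing_inv_mul _ K.isUnit_det_massMatrix,
      Matrix.one_mulVec]
  simp only [precGrad, precGradMatrix, Matrix.mul_assoc, Matrix.diagonal_mul, hinv, hDi]
  simp

/-! ### Cancellation of the antidiffusive fluxes -/

variable {m : ℕ}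

theorem mulVec_integral {α : Type*} [MeasurableSpace α] {μ : Measure α}
    (A : Matrix (Fin m) (Fin (n + 1)) ℝ) {f : α → Vec (n + 1)} (hf : Integrable f μ) :
    ∫ x, A *ᵥ ⇑(f x) ∂μ = A *ᵥ ⇑(∫ x, f x ∂μ) :=
  (LinearMap.toContinuousLinearMap
    (A.mulVecLin ∘ₗ (WithLp.linearEquiv 2 ℝ (Fin (n + 1) → ℝ)).toLinearMap)).integral_comp_comm hf

theorem faceIntegral_basis_eq_zero {V : Type*} [NormedAddCommGroup V] [NormedSpace ℝ V]
    {i : Node K.block p} {k : Face K.block} (h : ¬ NodeOnFace i k) (g : Vec (n + 1) → V) :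
    K.faceIntegral k (fun x => K.basis i x • g x) = 0 := by
  refine setIntegral_eq_zero_of_forall_eq_zero fun s hs => ?_
  have h1 : K.basis i (K.param k s) = 0 := by
    rw [basis, param, K.map.left_inv (K.subset_source hs)]
    exact refBasis_eq_zero_of_not_nodeOnFace h (bary_faceParam k s)
  simp only [h1, zero_smul, smul_zero]

theorem faceIntegral_basis_smul_mulVec (i : Node K.block p) (k : Face K.block)
    (A : Matrix (Fin m) (Fin (n + 1)) ℝ) :
    K.faceIntegral k (fun x => K.basis i x • (A *ᵥ ⇑(K.normal k x))) =
      A *ᵥ ⇑(K.faceIntegral k fun x => K.basis i x • K.normal k x) := by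
  rw [faceIntegral, faceIntegral, ← mulVec_integral A
    (K.integrableOn_areaElement_smul_normal (K.contDiffOn_basis i).continuousOn k)]
  simp [Matrix.mulVec_smul]

-- The sum extends to all faces since the added integrals vanish; then the constant matrix is pulled
-- out and the divergence theorem applies.
open Classical in
theorem sum_faceIntegral_basis (i : Node K.block p) (A : Matrix (Fin m) (Fin (n + 1)) ℝ) :
    (∑ k with NodeOnFace i k,
      K.faceIntegral k fun x => K.basis i x • (A *ᵥ ⇑(K.normal k x))) =
      A *ᵥ ⇑(∫ x in K.carrier, gradient (K.basis i) x) := by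
  rw [Finset.sum_filter_of_ne fun k _ hk => by
    by_contra h
    exact hk (K.faceIntegral_basis_eq_zero h _)]
  simp only [faceIntegral_basis_smul_mulVec]
  rw [K.integral_gradient_eq_sum_faceIntegral (K.contDiffOn_basis i), WithLp.ofLp_sum,
    Matrix.mulVec_sum]

/-- The gradients sum to zero pointwise; continuity of the flux along `U_h` gives the integrability
needed to move the sum inside. -/
theorem sum_integral_flux_mulVec_gradient {F : (Fin m → ℝ) → Matrix (Fin m) (Fin (n + 1)) ℝ}
    {D : Set (Fin m → ℝ)} (hF : ContinuousOn F D) {u : Node K.block p → Fin m → ℝ}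
    (hu : ∀ x ∈ K.carrier, K.solution u x ∈ D) :
    ∑ i : Node K.block p, ∫ x in K.carrier, F (K.solution u x) *ᵥ ⇑(gradient (K.basis i) x) = 0 := by
  have hU : ContinuousOn (K.solution u) K.carrier :=
    continuousOn_finsetSum _ fun j _ => (K.continuousOn_basis j).smul continuousOn_const
  have hFU : ContinuousOn (fun x => F (K.solution u x)) K.carrier := hF.comp hU hu
  rw [← integral_finsetSum]
  · refine setIntegral_eq_zero_of_forall_eq_zero fun x hx => ?_
    rw [← Matrix.mulVec_sum, ← WithLp.ofLp_sum,
      K.sum_gradient_basis (K.carrier_subset_target hx)]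
    simp
  · intro i _
    refine ContinuousOn.integrableOn_compact K.isCompact_carrier ?_
    exact (Continuous.matrix_mulVec continuous_fst continuous_snd).comp_continuousOn
      (hFU.prodMk ((PiLp.continuous_ofLp 2 _).comp_continuousOn (K.continuousOn_gradient_basis i)))

theorem dissipation_comm (lam : (Fin m → ℝ) → (Fin m → ℝ) → Vec (n + 1) → ℝ)
    (u : Node K.block p → Fin m → ℝ) (i j : Node K.block p) :
    K.dissipation lam u i j = K.dissipation lam u j i := by
  by_cases h : i = j
  · rw [h]
  · rw [dissipation, dissipation, if_neg h, if_neg (Ne.symm h), max_comm]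

theorem sum_dissipation (lam : (Fin m → ℝ) → (Fin m → ℝ) → Vec (n + 1) → ℝ)
    (u : Node K.block p → Fin m → ℝ) :
    ∑ i, ∑ j, K.dissipation lam u i j • (u j - u i) = 0 := by
  have h : ∑ i, ∑ j, K.dissipation lam u i j • (u j - u i) =
      -∑ i, ∑ j, K.dissipation lam u i j • (u j - u i) := by
    conv_lhs => rw [Finset.sum_comm]
    rw [← Finset.sum_neg_distrib]
    refine Finset.sum_congr rfl fun i _ => ?_
    rw [← Finset.sum_neg_distrib]
    refine Finset.sum_congr rfl fun j _ => ?_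
    rw [K.dissipation_comm, ← smul_neg, neg_sub]
  exact self_eq_neg.1 h

/-- Zero row sums remove the `f i` part, and the column sums evaluate the `f j` part. -/
theorem sum_flux_mulVec_precGrad (f : Node K.block p → Matrix (Fin m) (Fin (n + 1)) ℝ) :
    ∑ i, ∑ j, (f j - f i) *ᵥ ⇑(K.precGrad i j) =
      ∑ j, f j *ᵥ ⇑(∫ x in K.carrier, gradient (K.basis j) x) := by
  simp only [Matrix.sub_mulVec, Finset.sum_sub_distrib]
  have h1 : ∀ i, ∑ j, f i *ᵥ ⇑(K.precGrad i j) = 0 := fun i => by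
    rw [← Matrix.mulVec_sum, ← WithLp.ofLp_sum, K.sum_precGrad_right]
    simp
  simp only [h1, Finset.sum_const_zero, sub_zero]
  rw [Finset.sum_comm]
  refine Finset.sum_congr rfl fun j _ => ?_
  rw [← Matrix.mulVec_sum, ← WithLp.ofLp_sum, K.sum_precGrad_left]

theorem sum_mass_defect (udot : Node K.block p → Fin m → ℝ) :
    ∑ i, ∑ j, ((if i = j then K.lumpedMass p i else 0) - K.massMatrix p i j) • udot j = 0 := by
  rw [Finset.sum_comm]
  refine Finset.sum_eq_zero fun j _ => ?_
  rw [← Finset.sum_smul, Finset.sum_sub_distrib]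
  simp [lumpedMass, K.massMatrix_comm j]

theorem sum_antidiffusiveFlux_univ {F : (Fin m → ℝ) → Matrix (Fin m) (Fin (n + 1)) ℝ}
    {D : Set (Fin m → ℝ)} (hF : ContinuousOn F D)
    (lam : (Fin m → ℝ) → (Fin m → ℝ) → Vec (n + 1) → ℝ) {u : Node K.block p → Fin m → ℝ}
    (udot : Node K.block p → Fin m → ℝ) (hu : ∀ x ∈ K.carrier, K.solution u x ∈ D) :
    ∑ i, K.antidiffusiveFlux F lam (fun _ => Finset.univ) u udot i = 0 := by
  simp only [antidiffusiveFlux, sum_faceIntegral_basis]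
  rw [Finset.sum_sub_distrib, Finset.sum_add_distrib, Finset.sum_sub_distrib,
    K.sum_integral_flux_mulVec_gradient hF hu]
  simp only [Finset.sum_sub_distrib (f := fun j => K.dissipation lam u _ j • (u j - u _))]
  rw [Finset.sum_sub_distrib, K.sum_dissipation, K.sum_flux_mulVec_precGrad fun i => F (u i)]
  have h := K.sum_mass_defect udot
  rw [h]
  simp

/-- `d_{ij}` involves both `c̃_{ij}` and `c̃_{ji}`; both vanish because the neighbour relation is
symmetric. -/
theorem dissipation_smul_sub_eq_zero (hK : K.ConstantJacobian)
    (lam : (Fin m → ℝ) → (Fin m → ℝ) → Vec (n + 1) → ℝ)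
    (u : Node K.block p → Fin m → ℝ) {i j : Node K.block p} (hij : j ∉ nearestNeighbors i) :
    K.dissipation lam u i j • (u j - u i) = 0 := by
  by_cases h : i = j
  · rw [h, sub_self, smul_zero]
  · have hji : i ∉ nearestNeighbors j := fun h => hij (mem_nearestNeighbors_comm.1 h)
    simp [dissipation, h, viscosity, K.precGrad_eq_zero hK hij, K.precGrad_eq_zero hK hji]

theorem antidiffusiveFlux_nearestNeighbors (hK : K.ConstantJacobian)
    (F : (Fin m → ℝ) → Matrix (Fin m) (Fin (n + 1)) ℝ)
    (lam : (Fin m → ℝ) → (Fin m → ℝ) → Vec (n + 1) → ℝ) (u udot : Node K.block p → Fin m → ℝ)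
    (i : Node K.block p) :
    K.antidiffusiveFlux F lam nearestNeighbors u udot i =
      K.antidiffusiveFlux F lam (fun _ => Finset.univ) u udot i := by
  unfold antidiffusiveFlux
  rw [Finset.sum_subset (Finset.subset_univ (nearestNeighbors i)) fun j _ hj => by
    rw [K.dissipation_smul_sub_eq_zero hK lam u hj, K.precGrad_eq_zero hK hj]
    simp]

end Element

end BernsteinDG

end

theorem lemma2 {n m p E : ℕ} (hd : n + 1 ≤ 3) (K : Fin E → BernsteinDG.Element n)
    (F : (Fin m → ℝ) → Matrix (Fin m) (Fin (n + 1)) ℝ) (D : Set (Fin m → ℝ))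
    (hF : ContinuousOn F D)
    (lam : (Fin m → ℝ) → (Fin m → ℝ) → BernsteinDG.Vec (n + 1) → ℝ)
    (u udot : (e : Fin E) → BernsteinDG.Node (K e).block p → Fin m → ℝ)
    (hu : ∀ e, ∀ x ∈ (K e).carrier, (K e).solution (u e) x ∈ D) :
    ∀ e : Fin E,
      (∑ i, (K e).antidiffusiveFlux F lam (fun _ => Finset.univ) (u e) (udot e) i = 0) ∧
      ((K e).ConstantJacobian →
        ∑ i, (K e).antidiffusiveFlux F lam BernsteinDG.nearestNeighbors (u e) (udot e) i = 0) := by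
  intro e
  have h := (K e).sum_antidiffusiveFlux_univ hF lam (udot e) (hu e)
  refine ⟨h, fun hK => ?_⟩
  simp only [(K e).antidiffusiveFlux_nearestNeighbors hK]
  exact h
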